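/- Let $p\in[0,+\infty]$ and let $\lfloor p\rfloor$ be its integer part. For $p=+\infty$, a function is $O(|w|^{-\lfloor p\rfloor-1})$ as $w\to\infty$ if it vanishes for all sufficiently large $|w|$. Let $\mathrm{mon}_p$ be the class of functions $z\mapsto \operatorname{Re}(cz^k)$ on $\mathbb C$ with $c\in\mathbb C$ and integers $0\le k\le p$, and let $\mathrm{lnmon}_p$ be the union of $\mathrm{mon}_p$ with the functions $z\mapsto\ln|z-w|$, $w\in\mathbb C$ (with value $-\infty$ at $z=w$). For positive Borel measures $\delta,\omega$ on $\mathbb C$ and a class $H$ of functions $\mathbb C\to[-\infty,+\infty]$, $\omega$ is an $H$-balayage of $\delta$ if for each $h\in H$ the integrals $\int h\,d\delta$ and $\int h\,d\omega$ are well defined in $[-\infty,+\infty]$ and $\int h\,d\delta\le\int h\,d\omega$. Put $\mathrm{pt}_\mu(z)=\int\ln|w-z|\,d\mu(w)$. Subharmonic functions are $[-\infty,+\infty)$-valued and may be identically $-\infty$. The Riesz measure of a subharmonic function $u\not\equiv-\infty$ on $\mathbb C$ is the positive locally finite Borel measure $\frac1{2\pi}\Delta u$, where $\Delta$ is the distributional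 Laplacian. **Direct part.** Let $\delta,\omega$ be positive locally finite Borel measures on $\mathbb C$ with compact support. If $\omega$ is a $\mathrm{mon}_p$-balayage of $\delta$, then $\mathrm{pt}_\delta$ and $\mathrm{pt}_\omega$ are subharmonic on $\mathbb C$ and not identically $-\infty$, they are harmonic on $\mathbb C\setminus\operatorname{supp}\delta$ and $\mathbb C\setminus\operatorname{supp}\omega$ respectively, and $$\mathrm{pt}_\omega(w)=\mathrm{pt}_\delta(w)+O\bigl(|w|^{-\lfloor p\rfloor-1}\bigr)\quad\text{as } w\to\infty .$$ If $\omega$ is a $\mathrm{lnmon}_p$-balayage of $\delta$, then in addition $\mathrm{pt}_\omega\ge\mathrm{pt}_\delta$ on $\mathbb C$. **Converse part.** Let $S\subset\mathbb C$ be bounded, and let $d,v$ be subharmonic functions on $\mathbb C$, each harmonic on an open neighbourhood of $\mathbb C\setminus S$, such that $v(w)=d(w)+O(|w|^{-\lfloor p\rfloor-1})$ as $w\to\infty$. Then $d$ and $v$ have Riesz measures $\delta$ and $\omega$, which are locally finite with compact support and vanish outside the closure of $S$, and $\omega$ is a $\mathrm{mon}_p$-balayage of $\delta$. If moreover $v\ge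 d$ on $\mathbb C$, then $\omega$ is a $\mathrm{lnmon}_p$-balayage of $\delta$. -/

import Mathlib

open MeasureTheory Filter Set
open scoped ENNReal Topology Laplacian

namespace MonBalayage

noncomputable section

/-- The integral of an extended real valued function, as the integral of its positive part minus
the integral of its negative part. It is meaningful when `IntegralWellDefined` holds. -/
def eintegral {X : Type*} [MeasurableSpace X] (μ : Measure X) (h : X → EReal) : EReal :=
  ((∫⁻ x, (h x).toENNReal ∂μ : ℝ≥0∞) : EReal) - ((∫⁻ x, (-h x).toENNReal ∂μ : ℝ≥0∞) : EReal)

/-- The integral of `h` is well defined in `[-∞, +∞]`: the integrals of the positive and of the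
negative part are not both infinite. -/
def IntegralWellDefined {X : Type*} [MeasurableSpace X] (μ : Measure X) (h : X → EReal) : Prop :=
  ∫⁻ x, (h x).toENNReal ∂μ ≠ ⊤ ∨ ∫⁻ x, (-h x).toENNReal ∂μ ≠ ⊤

/-- `ω` is a balayage of `δ` with respect to the class `H`. -/
def IsBalayage (H : Set (ℂ → EReal)) (ω δ : Measure ℂ) : Prop :=
  ∀ h ∈ H, IntegralWellDefined δ h ∧ IntegralWellDefined ω h ∧ eintegral δ h ≤ eintegral ω h

/-- Positive locally finite Borel measures on `ℂ` with compact support. -/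
structure IsCompactMeasure (μ : Measure ℂ) : Prop where
  locallyFinite : IsLocallyFiniteMeasure μ
  isCompact_support : IsCompact μ.support

/-- The class of the functions `z ↦ Re (c * z ^ k)`, with `c` complex and `k` a natural number
with `k ≤ p`. -/
def mon (p : ℝ≥0∞) : Set (ℂ → EReal) :=
  {h | ∃ (k : ℕ) (c : ℂ), (k : ℝ≥0∞) ≤ p ∧ h = fun z => (((c * z ^ k).re : ℝ) : EReal)}

open scoped Classical in
/-- The logarithmic kernel `log |w - z|`, with the value `-∞` on the diagonal. -/
def logKernel (w z : ℂ) : EReal :=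
  if w = z then ⊥ else ((Real.log ‖w - z‖ : ℝ) : EReal)

/-- The class of the functions `z ↦ log |z - w|`, where `w` is a complex number. -/
def lnC : Set (ℂ → EReal) := {h | ∃ w : ℂ, h = fun z => logKernel z w}

/-- The union of the logarithmic functions and of the monomials of degree at most `p`. -/
def lnmon (p : ℝ≥0∞) : Set (ℂ → EReal) := lnC ∪ mon p

/-- The logarithmic potential of a measure. -/
def pt (μ : Measure ℂ) (z : ℂ) : EReal := eintegral μ (fun w => logKernel w z)

/-- The mean value of `u` over the circle with centre `z` and radius `r`. -/
def circleMean (u : ℂ → EReal) (z : ℂ) (r : ℝ) : EReal :=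
  (((2 * Real.pi)⁻¹ : ℝ) : EReal) *
    eintegral (volume.restrict (Ioc (0 : ℝ) (2 * Real.pi))) (fun θ => u (circleMap z r θ))

/-- Subharmonic functions on `ℂ`; the function identically equal to `-∞` is allowed. -/
structure IsSubharmonic (u : ℂ → EReal) : Prop where
  ne_top : ∀ z, u z ≠ ⊤
  upperSemicontinuous : UpperSemicontinuous u
  le_circleMean : ∀ (z : ℂ) (r : ℝ), 0 < r → u z ≤ circleMean u z r

/-- Subharmonic functions on `ℂ` that are not identically `-∞`. -/
def IsProperSubharmonic (u : ℂ → EReal) : Prop := IsSubharmonic u ∧ ∃ z, u z ≠ ⊥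

/-- `u` is finite and harmonic on an open neighbourhood of `A`. -/
def IsHarmonicNear (u : ℂ → EReal) (A : Set ℂ) : Prop :=
  ∃ (O : Set ℂ) (f : ℂ → ℝ), IsOpen O ∧ A ⊆ O ∧ InnerProductSpace.HarmonicOnNhd f O ∧
    ∀ z ∈ O, u z = ((f z : ℝ) : EReal)

/-- `μ` is the Riesz measure of `u`, that is, `u` is finite almost everywhere and locally
integrable, and its distributional Laplacian divided by `2 * π` is the locally finite measure
`μ`. -/
structure IsRieszMeasure (u : ℂ → EReal) (μ : Measure ℂ) : Prop where
  locallyFinite : IsLocallyFiniteMeasure μ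
  ae_finite : ∀ᵐ z : ℂ, u z ≠ ⊥ ∧ u z ≠ ⊤
  locallyIntegrable : LocallyIntegrable (fun z => (u z).toReal) (volume : Measure ℂ)
  integral_laplacian : ∀ φ : ℂ → ℝ, ContDiff ℝ ((⊤ : ℕ∞) : WithTop ℕ∞) φ → HasCompactSupport φ →
    (2 * Real.pi)⁻¹ * ∫ z, (u z).toReal * (Δ φ) z = ∫ z, φ z ∂μ

/-- The gauge `1 / |w| ^ (⌊p⌋ + 1)`, read as `0` (its value for `|w| > 1`) when `p = ∞`. -/
def decayRate (p : ℝ≥0∞) (w : ℂ) : ℝ :=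
  if p = ⊤ then 0 else 1 / ‖w‖ ^ (⌊p.toReal⌋₊ + 1)

/-- `u w = v w + O (1 / |w| ^ (⌊p⌋ + 1))` as `w` tends to infinity; both functions are finite
near infinity. -/
def EqUpToDecay (p : ℝ≥0∞) (u v : ℂ → EReal) : Prop :=
  (∀ᶠ w in Bornology.cobounded ℂ, (u w ≠ ⊥ ∧ u w ≠ ⊤) ∧ (v w ≠ ⊥ ∧ v w ≠ ⊤)) ∧
    (fun w => (u w).toReal - (v w).toReal) =O[Bornology.cobounded ℂ] decayRate p

end

end MonBalayage

open MonBalayage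

/-!
The direct part is a multipole expansion. For `μ` supported in the disc of radius `R` and
`2 * R ≤ ‖z‖`, the potential at `z` is `μ(ℂ) * log ‖z‖` plus the real part of the integral of
`log (1 - w / z)`. The Taylor polynomials of the logarithm only involve the moments of `μ`, and
`mon p`-balayage says that the moments of order at most `p` agree, so that the potentials differ by
the Taylor remainder (`abs_potential_sub_potential_le`); for `p = ∞` the remainder tends to zero
with the degree, so the difference is zero. Subharmonicity is obtained by approximating `log ‖z‖`
from above by `regLog ε z = log (‖z‖ ^ 2 + ε ^ 2) / 2`: the potential is a decreasing limit of
continuous functions, and the mean value inequality integrates that of the logarithm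
(`IsCompactMeasure.isSubharmonic_pt`). Off the support it is locally the real part of a
holomorphic function. The inequality between potentials is the definition of balayage of the
logarithmic kernels.

For the converse, the distributional Laplacian of a subharmonic function `u` is handled through
circle averages. They are symmetric for the integral pairing (`integral_mul_circleAverage`), and the
second order term of the average of a smooth function over a small circle is its Laplacian
(`abs_circleAverage_sub_le`). Hence the mean value inequality makes `∫ u * Δ φ` nonnegative for
`0 ≤ φ`, and the mean value property makes it vanish where `u` is harmonic. M. Riesz' extension
theorem and the Riesz–Markov–Kakutani theorem then give the Riesz measure
(`IsProperSubharmonic.exists_isRieszMeasure`), and any Riesz measure vanishes where `u` is harmonic.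

Balayage follows by testing: `∫ φ dω - ∫ φ dδ` is `∫ (v - d) * Δ φ / (2 * π)`. When `φ` is a
harmonic monomial of degree `k` cut off at scale `R`, its Laplacian lives on an annulus of area
comparable to `R ^ 2` and is `O (R ^ (k - 2))`, while `v - d` is `O (R ^ (-k - 1))` there, so the
pairing tends to zero. When `φ` is `regLog ε (z - w)` cut off at scale `R`, there is the additional
term where the cutoff is inactive, which is nonnegative because `regLog` is subharmonic and `d ≤ v`
(`integral_regLog_le`); letting `ε` tend to `0` gives the inequality of the potentials.
-/

namespace MonBalayage

/-! ### Extended real integrals -/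

section EIntegral

variable {X : Type*} [MeasurableSpace X] {μ : Measure X}

lemma eintegral_mono {h k : X → EReal} (hk : ∀ᵐ x ∂μ, h x ≤ k x) :
    eintegral μ h ≤ eintegral μ k := by
  unfold eintegral
  refine EReal.sub_le_sub ?_ ?_
  · exact_mod_cast lintegral_mono_ae (hk.mono fun x hx => EReal.toENNReal_le_toENNReal hx)
  · exact_mod_cast lintegral_mono_ae (hk.mono fun x hx =>
      EReal.toENNReal_le_toENNReal (EReal.neg_le_neg_iff.2 hx))

lemma eintegral_congr {h k : X → EReal} (hk : ∀ᵐ x ∂μ, h x = k x) :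
    eintegral μ h = eintegral μ k :=
  le_antisymm (eintegral_mono (hk.mono fun _ hx => hx.le))
    (eintegral_mono (hk.mono fun _ hx => hx.ge))

lemma lintegral_toENNReal_coe_ne_top {f : X → ℝ} (hf : Integrable f μ) :
    ∫⁻ x, ((f x : EReal)).toENNReal ∂μ ≠ ⊤ := by
  simp only [EReal.real_coe_toENNReal]
  exact hf.lintegral_lt_top.ne

lemma eintegral_coe {f : X → ℝ} (hf : Integrable f μ) :
    eintegral μ (fun x => (f x : EReal)) = ((∫ x, f x ∂μ : ℝ) : EReal) := by
  have h1 := lintegral_toENNReal_coe_ne_top hf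
  have h2 := lintegral_toENNReal_coe_ne_top hf.neg
  rw [integral_eq_lintegral_pos_part_sub_lintegral_neg_part hf]
  unfold eintegral
  simp only [Pi.neg_apply, EReal.coe_neg] at h2
  simp only [← EReal.coe_neg, EReal.real_coe_toENNReal] at h1 h2 ⊢
  rw [EReal.coe_sub, EReal.coe_ennreal_toReal h1, EReal.coe_ennreal_toReal h2]

lemma integrable_toReal_of_lintegral_ne_top {h : X → EReal} (hm : AEMeasurable h μ)
    (h1 : ∫⁻ x, (h x).toENNReal ∂μ ≠ ⊤) (h2 : ∫⁻ x, (-h x).toENNReal ∂μ ≠ ⊤) :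
    Integrable (fun x => (h x).toReal) μ ∧ ∀ᵐ x ∂μ, h x = ((h x).toReal : EReal) := by
  have a1 := ae_lt_top' hm.ereal_toENNReal h1
  have a2 := ae_lt_top' hm.neg.ereal_toENNReal h2
  have a3 : ∀ᵐ x ∂μ, h x = ((h x).toReal : EReal) := by
    filter_upwards [a1, a2] with x x1 x2
    refine (EReal.coe_toReal ?_ ?_).symm
    · intro h; simp [h] at x1
    · intro h; simp [h] at x2
  refine ⟨⟨hm.ereal_toReal.aestronglyMeasurable, ?_⟩, a3⟩
  rw [hasFiniteIntegral_iff_norm]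
  have key : ∫⁻ x, ENNReal.ofReal ‖(h x).toReal‖ ∂μ ≤
      ∫⁻ x, ((h x).toENNReal + (-h x).toENNReal) ∂μ := by
    refine lintegral_mono_ae (a3.mono fun x hx => ?_)
    rw [hx, ← EReal.coe_neg, EReal.real_coe_toENNReal, EReal.real_coe_toENNReal, EReal.toReal_coe,
      Real.norm_eq_abs]
    rcases le_total 0 (h x).toReal with h0 | h0
    · rw [abs_of_nonneg h0]; exact le_self_add
    · rw [abs_of_nonpos h0]; exact le_add_self
  refine key.trans_lt ?_
  rw [lintegral_add_left' hm.ereal_toENNReal]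
  exact ENNReal.add_lt_top.2 ⟨h1.lt_top, h2.lt_top⟩

/-- An extended real function whose positive part is integrable either has integral `-∞`, or is
almost everywhere finite and integrable. -/
lemma integrable_toReal_of_eintegral_ne_bot {h : X → EReal} (hm : AEMeasurable h μ)
    (h1 : ∫⁻ x, (h x).toENNReal ∂μ ≠ ⊤) (h2 : eintegral μ h ≠ ⊥) :
    Integrable (fun x => (h x).toReal) μ ∧ (∀ᵐ x ∂μ, h x = ((h x).toReal : EReal)) ∧
      eintegral μ h = ((∫ x, (h x).toReal ∂μ : ℝ) : EReal) := by
  have h3 : ∫⁻ x, (-h x).toENNReal ∂μ ≠ ⊤ := by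
    intro h3
    apply h2
    simp [eintegral, h3]
  obtain ⟨hi, he⟩ := integrable_toReal_of_lintegral_ne_top hm h1 h3
  exact ⟨hi, he, (eintegral_congr he).trans (eintegral_coe hi)⟩

/-- Monotone convergence for a decreasing sequence of integrable functions with an extended real
limit. -/
lemma le_eintegral_of_antitone {g : ℕ → X → ℝ} {h : X → EReal} {c : ℝ}
    (hm : AEMeasurable h μ) (hg : ∀ n, Integrable (g n) μ)
    (hanti : ∀ᵐ x ∂μ, Antitone fun n => g n x)
    (hlim : ∀ᵐ x ∂μ, Tendsto (fun n => ((g n x : ℝ) : EReal)) atTop (𝓝 (h x)))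
    (hc : ∀ n, c ≤ ∫ x, g n x ∂μ) : (c : EReal) ≤ eintegral μ h := by
  have hle : ∀ᵐ x ∂μ, ∀ n, h x ≤ (g n x : EReal) := by
    filter_upwards [hanti, hlim] with x x1 x2 n
    refine le_of_tendsto x2 (eventually_atTop.2 ⟨n, fun m hm => ?_⟩)
    exact_mod_cast x1 hm
  have hpos : ∫⁻ x, (h x).toENNReal ∂μ ≠ ⊤ := by
    refine ne_top_of_le_ne_top (lintegral_toENNReal_coe_ne_top (hg 0)) (lintegral_mono_ae ?_)
    filter_upwards [hle] with x hx using EReal.toENNReal_le_toENNReal (hx 0)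
  -- Fatou's lemma for the negative parts.
  have hneg : ∫⁻ x, (-h x).toENNReal ∂μ ≠ ⊤ := by
    have key : ∫⁻ x, (-h x).toENNReal ∂μ ≤
        liminf (fun n => ∫⁻ x, ENNReal.ofReal (-g n x) ∂μ) atTop := by
      refine le_trans (lintegral_mono_ae ?_) (lintegral_liminf_le' fun n =>
        (hg n).aestronglyMeasurable.aemeasurable.neg.ennreal_ofReal)
      filter_upwards [hlim] with x hx
      have : Tendsto (fun n => ENNReal.ofReal (-g n x)) atTop (𝓝 ((-h x).toENNReal)) := by
        have h1 := (EReal.continuous_toENNReal.tendsto _).comp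
          ((continuous_neg.tendsto _).comp hx)
        refine h1.congr fun n => ?_
        simp [← EReal.coe_neg]
      rw [this.liminf_eq]
    have bd : ∀ n, ∫⁻ x, ENNReal.ofReal (-g n x) ∂μ ≤
        ENNReal.ofReal (∫ x, max (g 0 x) 0 ∂μ - c) := by
      intro n
      have e1 : ∫⁻ x, ENNReal.ofReal (-g n x) ∂μ =
          ENNReal.ofReal (∫ x, max (-g n x) 0 ∂μ) := by
        have := ofReal_integral_eq_lintegral_ofReal (hg n).neg.pos_part
          (ae_of_all _ fun x => le_max_right _ _)
        simp only [Pi.neg_apply] at this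
        rw [this]
        refine lintegral_congr fun x => ?_
        simp [ENNReal.ofReal_max]
      rw [e1]
      refine ENNReal.ofReal_le_ofReal ?_
      have e2 : ∫ x, max (-g n x) 0 ∂μ ≤ ∫ x, (max (g 0 x) 0 - g n x) ∂μ := by
        refine integral_mono_ae (hg n).neg.pos_part ((hg 0).pos_part.sub (hg n)) ?_
        filter_upwards [hanti] with x hx
        have := hx (Nat.zero_le n)
        simp only at this
        rcases le_total (g 0 x) 0 with h | h <;> rcases le_total (g n x) 0 with h' | h' <;>
          simp [h, h'] <;> linarith
      rw [integral_sub (hg 0).pos_part (hg n)] at e2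
      linarith [hc n]
    refine ne_top_of_le_ne_top
      (ENNReal.ofReal_ne_top (r := ∫ x, max (g 0 x) 0 ∂μ - c)) (key.trans ?_)
    refine liminf_le_of_le (by isBoundedDefault) fun b hb => ?_
    obtain ⟨n, hn⟩ := hb.exists
    exact hn.trans (bd n)
  obtain ⟨hi, he⟩ := integrable_toReal_of_lintegral_ne_top hm hpos hneg
  rw [(eintegral_congr he).trans (eintegral_coe hi), EReal.coe_le_coe_iff]
  refine ge_of_tendsto' (x := atTop) (integral_tendsto_of_tendsto_of_antitone hg hi hanti ?_) hc
  filter_upwards [hlim, he] with x hx hex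
  rw [hex] at hx
  exact_mod_cast hx

end EIntegral

/-! ### The regularized logarithm -/

noncomputable section

/-- A smooth regularization of `log ‖z‖`, decreasing to it as `ε` decreases to `0`. -/
def regLog (ε : ℝ) (z : ℂ) : ℝ := 1 / 2 * Real.log (‖z‖ ^ 2 + ε ^ 2)

lemma norm_sq_add_sq_pos {ε : ℝ} (hε : 0 < ε) (z : ℂ) : 0 < ‖z‖ ^ 2 + ε ^ 2 := by positivity

lemma continuous_regLog {ε : ℝ} (hε : 0 < ε) : Continuous (regLog ε) := by
  unfold regLog
  refine continuous_const.mul (Continuous.log (by fun_prop) fun z => (norm_sq_add_sq_pos hε z).ne')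

lemma regLog_mono {ε η : ℝ} (hε : 0 < ε) (h : ε ≤ η) (z : ℂ) : regLog ε z ≤ regLog η z := by
  unfold regLog
  have := norm_sq_add_sq_pos hε z
  gcongr

lemma log_norm_le_regLog {z : ℂ} (ε : ℝ) (hz : z ≠ 0) : Real.log ‖z‖ ≤ regLog ε z := by
  unfold regLog
  have h0 : 0 < ‖z‖ := norm_pos_iff.2 hz
  have : Real.log (‖z‖ ^ 2) ≤ Real.log (‖z‖ ^ 2 + ε ^ 2) :=
    Real.log_le_log (by positivity) (by nlinarith [sq_nonneg ε])
  rw [Real.log_pow] at this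
  push_cast at this
  linarith

lemma logKernel_le_regLog {ε : ℝ} (w z : ℂ) : logKernel w z ≤ (regLog ε (w - z) : ℝ) := by
  unfold logKernel
  split_ifs with h
  · exact bot_le
  · exact_mod_cast log_norm_le_regLog ε (sub_ne_zero.2 h)

/-- The regularization parameters used to approximate the logarithmic kernel. -/
def regSeq (n : ℕ) : ℝ := 1 / ((n : ℝ) + 1)

lemma regSeq_pos (n : ℕ) : 0 < regSeq n := Nat.one_div_pos_of_nat

lemma regSeq_antitone : Antitone regSeq := fun _ _ h => Nat.one_div_le_one_div h

lemma antitone_regLog (z : ℂ) : Antitone fun n => regLog (regSeq n) z :=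
  fun _ _ h => regLog_mono (regSeq_pos _) (regSeq_antitone h) z

lemma tendsto_regLog (w z : ℂ) :
    Tendsto (fun n => ((regLog (regSeq n) (w - z) : ℝ) : EReal)) atTop (𝓝 (logKernel w z)) := by
  have h0 : Tendsto regSeq atTop (𝓝 0) := tendsto_one_div_add_atTop_nhds_zero_nat
  have h1 : Tendsto (fun n => ‖w - z‖ ^ 2 + regSeq n ^ 2) atTop (𝓝 (‖w - z‖ ^ 2)) := by
    simpa using (tendsto_const_nhds (x := ‖w - z‖ ^ 2)).add (h0.pow 2)
  unfold logKernel regLog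
  split_ifs with h
  · rw [EReal.tendsto_coe_nhds_bot_iff]
    refine Tendsto.const_mul_atBot (by norm_num) (Real.tendsto_log_nhdsGT_zero.comp ?_)
    refine tendsto_nhdsWithin_iff.2 ⟨by simpa [h] using h1, Eventually.of_forall fun n =>
      norm_sq_add_sq_pos (regSeq_pos n) _⟩
  · have hp : 0 < ‖w - z‖ := norm_pos_iff.2 (sub_ne_zero.2 h)
    rw [EReal.tendsto_coe]
    have h2 := (h1.log (by positivity)).const_mul (1 / 2)
    rw [Real.log_pow] at h2
    convert h2 using 2
    push_cast; ring

lemma measurable_logKernel (z : ℂ) : Measurable fun w => logKernel w z :=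
  measurable_of_tendsto_metrizable
    (fun n => (((continuous_regLog (regSeq_pos n)).comp
      (continuous_id.sub continuous_const)).measurable.coe_real_ereal))
    (tendsto_pi_nhds.2 fun w => tendsto_regLog w z)

end

end MonBalayage

namespace MonBalayage

/-! ### Logarithmic potentials are subharmonic -/

section Potential

variable {μ : Measure ℂ}

lemma IsCompactMeasure.ae_mem_support (_ : IsCompactMeasure μ) : ∀ᵐ w ∂μ, w ∈ μ.support :=
  Measure.support_mem_ae

lemma IsCompactMeasure.restrict_support (hμ : IsCompactMeasure μ) :
    μ.restrict μ.support = μ :=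
  Measure.restrict_eq_self_of_ae_mem hμ.ae_mem_support

lemma IsCompactMeasure.isFiniteMeasure (hμ : IsCompactMeasure μ) : IsFiniteMeasure μ := by
  have := hμ.locallyFinite
  rw [← hμ.restrict_support]
  exact ⟨by simpa using hμ.isCompact_support.measure_lt_top⟩

lemma IsCompactMeasure.integrable {E : Type*} [NormedAddCommGroup E] {f : ℂ → E}
    (hμ : IsCompactMeasure μ) (hf : ContinuousOn f μ.support) : Integrable f μ := by
  have := hμ.locallyFinite
  have h := hf.integrableOn_compact hμ.isCompact_support (μ := μ)
  rwa [IntegrableOn, hμ.restrict_support] at h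

lemma IsCompactMeasure.continuous_integral {f : ℂ → ℂ → ℝ} (hμ : IsCompactMeasure μ)
    (hf : Continuous (Function.uncurry f)) : Continuous fun z => ∫ w, f z w ∂μ := by
  have := hμ.locallyFinite
  have h := continuous_parametric_integral_of_continuous (μ := μ) hf hμ.isCompact_support
  rwa [hμ.restrict_support] at h

lemma IsCompactMeasure.integrable_regLog (hμ : IsCompactMeasure μ) {ε : ℝ} (hε : 0 < ε) (z : ℂ) :
    Integrable (fun w => regLog ε (w - z)) μ :=
  hμ.integrable ((continuous_regLog hε).comp (by fun_prop)).continuousOn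

lemma IsCompactMeasure.continuous_integral_regLog (hμ : IsCompactMeasure μ) {ε : ℝ} (hε : 0 < ε) :
    Continuous fun z => ∫ w, regLog ε (w - z) ∂μ :=
  hμ.continuous_integral (f := fun z w => regLog ε (w - z))
    ((continuous_regLog hε).comp (by fun_prop))

lemma IsCompactMeasure.lintegral_logKernel_ne_top (hμ : IsCompactMeasure μ) (z : ℂ) :
    ∫⁻ w, (logKernel w z).toENNReal ∂μ ≠ ⊤ :=
  ne_top_of_le_ne_top (lintegral_toENNReal_coe_ne_top (hμ.integrable_regLog one_pos z))
    (lintegral_mono fun w => EReal.toENNReal_le_toENNReal (logKernel_le_regLog w z))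

lemma IsCompactMeasure.pt_le (hμ : IsCompactMeasure μ) {ε : ℝ} (hε : 0 < ε) (z : ℂ) :
    pt μ z ≤ ((∫ w, regLog ε (w - z) ∂μ : ℝ) : EReal) := by
  rw [← eintegral_coe (hμ.integrable_regLog hε z)]
  exact eintegral_mono (ae_of_all _ fun w => logKernel_le_regLog w z)

lemma IsCompactMeasure.le_pt (hμ : IsCompactMeasure μ) {z : ℂ} {c : ℝ}
    (hc : ∀ n, c ≤ ∫ w, regLog (regSeq n) (w - z) ∂μ) : (c : EReal) ≤ pt μ z :=
  le_eintegral_of_antitone (measurable_logKernel z).aemeasurable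
    (fun n => hμ.integrable_regLog (regSeq_pos n) z)
    (ae_of_all _ fun w => antitone_regLog (w - z)) (ae_of_all _ fun w => tendsto_regLog w z) hc

/-- The potential is the infimum of the continuous potentials with regularized kernels. -/
lemma IsCompactMeasure.pt_eq_iInf (hμ : IsCompactMeasure μ) (z : ℂ) :
    pt μ z = ⨅ n, ((∫ w, regLog (regSeq n) (w - z) ∂μ : ℝ) : EReal) := by
  refine le_antisymm (le_iInf fun n => hμ.pt_le (regSeq_pos n) z) ?_
  refine EReal.ge_of_forall_gt_iff_ge.1 fun c hc => hμ.le_pt fun n => ?_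
  exact_mod_cast hc.le.trans (iInf_le _ n)

lemma IsCompactMeasure.tendsto_integral_regLog (hμ : IsCompactMeasure μ) (z : ℂ) :
    Tendsto (fun n => ((∫ w, regLog (regSeq n) (w - z) ∂μ : ℝ) : EReal)) atTop (𝓝 (pt μ z)) := by
  rw [hμ.pt_eq_iInf]
  refine tendsto_atTop_iInf fun m n h => ?_
  exact_mod_cast integral_mono (hμ.integrable_regLog (regSeq_pos n) z)
    (hμ.integrable_regLog (regSeq_pos m) z) fun w => antitone_regLog (w - z) h

lemma IsCompactMeasure.upperSemicontinuous_pt (hμ : IsCompactMeasure μ) :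
    UpperSemicontinuous (pt μ) := by
  rw [funext hμ.pt_eq_iInf]
  exact upperSemicontinuous_iInf fun n => (continuous_coe_real_ereal.comp
    (hμ.continuous_integral_regLog (regSeq_pos n))).upperSemicontinuous

/-- The logarithm satisfies the sub-mean value inequality, and the regularized logarithm
dominates it. -/
lemma log_norm_le_circleAverage_regLog {ε : ℝ} (hε : 0 < ε) {w z : ℂ} (hwz : w ≠ z) {r : ℝ}
    (hr : 0 < r) : Real.log ‖w - z‖ ≤ Real.circleAverage (fun x => regLog ε (w - x)) z r := by
  have h1 := circleAverage_log_norm_sub_const_eq_log_radius_add_posLog (a := w) (c := z) hr.ne'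
  have h2 : Real.log ‖w - z‖ ≤ Real.log r + (r⁻¹ * ‖z - w‖).posLog := by
    have h0 : 0 < ‖z - w‖ := norm_pos_iff.2 (sub_ne_zero.2 hwz.symm)
    have h3 : Real.log (r⁻¹ * ‖z - w‖) ≤ (r⁻¹ * ‖z - w‖).posLog := le_max_right _ _
    rw [Real.log_mul (by positivity) h0.ne', Real.log_inv] at h3
    rw [norm_sub_rev]
    linarith
  refine h2.trans (h1.symm.le.trans ?_)
  rw [Real.circleAverage_def, Real.circleAverage_def]
  refine smul_le_smul_of_nonneg_left ?_ (by positivity)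
  refine intervalIntegral.integral_mono_ae (by positivity)
    (circleIntegrable_log_norm_sub_const r) (Continuous.intervalIntegrable
      ((continuous_regLog hε).comp (continuous_const.sub (continuous_circleMap z r))) _ _) ?_
  -- The two sides are compared off the null set of angles where the circle passes through `w`.
  have h4 := ((countable_singleton w).preimage_circleMap z hr.ne').ae_notMem volume
  filter_upwards [h4] with θ hθ
  simp only [mem_preimage, mem_singleton_iff] at hθ
  have := log_norm_le_regLog ε (sub_ne_zero.2 (Ne.symm hθ))
  rwa [norm_sub_rev] at this

lemma le_circleMean_of_mul_le_eintegral {u : ℂ → EReal} {z : ℂ} {r c : ℝ}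
    (h : ((2 * Real.pi * c : ℝ) : EReal) ≤
      eintegral (volume.restrict (Ioc (0 : ℝ) (2 * Real.pi))) (fun θ => u (circleMap z r θ))) :
    (c : EReal) ≤ circleMean u z r := by
  have h1 := mul_le_mul_of_nonneg_left h
    (by exact_mod_cast (by positivity : (0 : ℝ) ≤ (2 * Real.pi)⁻¹) :
      (0 : EReal) ≤ (((2 * Real.pi)⁻¹ : ℝ) : EReal))
  rw [← EReal.coe_mul, ← mul_assoc, inv_mul_cancel₀ (by positivity), one_mul] at h1
  exact h1

lemma IsCompactMeasure.circleAverage_integral_regLog (hμ : IsCompactMeasure μ) {ε : ℝ}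
    (hε : 0 < ε) (z : ℂ) (r : ℝ) :
    Integrable (fun w => Real.circleAverage (fun x => regLog ε (w - x)) z r) μ ∧
    ∫ w, Real.circleAverage (fun x => regLog ε (w - x)) z r ∂μ =
      Real.circleAverage (fun x => ∫ w, regLog ε (w - x) ∂μ) z r := by
  have := hμ.isFiniteMeasure
  have hc : Continuous (Function.uncurry fun w θ => regLog ε (w - circleMap z r θ)) :=
    (continuous_regLog hε).comp
      (continuous_fst.sub ((continuous_circleMap z r).comp continuous_snd))
  have hi : Integrable (Function.uncurry fun w θ => regLog ε (w - circleMap z r θ))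
      (μ.prod (volume.restrict (Ioc (0 : ℝ) (2 * Real.pi)))) := by
    have h := hc.continuousOn.integrableOn_compact
      (hμ.isCompact_support.prod (isCompact_Icc (a := (0 : ℝ)) (b := 2 * Real.pi)))
      (μ := μ.prod volume)
    have h := h.mono_set (prod_mono_right (s := μ.support) Ioc_subset_Icc_self)
    rwa [IntegrableOn, ← Measure.prod_restrict, hμ.restrict_support] at h
  simp only [Real.circleAverage_def, intervalIntegral.integral_of_le Real.two_pi_pos.le,
    smul_eq_mul]
  refine ⟨hi.integral_prod_left.const_mul _, ?_⟩
  rw [integral_const_mul, integral_integral_swap hi]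

lemma IsCompactMeasure.pt_le_circleMean (hμ : IsCompactMeasure μ) (z : ℂ) {r : ℝ} (hr : 0 < r) :
    pt μ z ≤ circleMean (pt μ) z r := by
  refine EReal.ge_of_forall_gt_iff_ge.1 fun c hc => le_circleMean_of_mul_le_eintegral ?_
  obtain ⟨hi, he, hp⟩ := integrable_toReal_of_eintegral_ne_bot
    (measurable_logKernel z).aemeasurable (hμ.lintegral_logKernel_ne_top z)
    (ne_bot_of_gt hc)
  have hc' : c < ∫ w, (logKernel w z).toReal ∂μ := by
    have := hc.trans_eq hp
    exact_mod_cast this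
  have hcont : ∀ n, Continuous fun θ => ∫ w, regLog (regSeq n) (w - circleMap z r θ) ∂μ :=
    fun n => (hμ.continuous_integral_regLog (regSeq_pos n)).comp (continuous_circleMap z r)
  refine le_eintegral_of_antitone
    (g := fun n θ => ∫ w, regLog (regSeq n) (w - circleMap z r θ) ∂μ) ?_ ?_ ?_ ?_ ?_
  · exact (hμ.upperSemicontinuous_pt.measurable.comp
      (continuous_circleMap z r).measurable).aemeasurable
  · exact fun n => ((hcont n).integrableOn_Icc).mono_set Ioc_subset_Icc_self
  · exact ae_of_all _ fun θ m n h => integral_mono (hμ.integrable_regLog (regSeq_pos n) _)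
      (hμ.integrable_regLog (regSeq_pos m) _) fun w => antitone_regLog _ h
  · exact ae_of_all _ fun θ => hμ.tendsto_integral_regLog _
  · intro n
    obtain ⟨h1, h2⟩ := hμ.circleAverage_integral_regLog (regSeq_pos n) z r
    have h3 : ∫ w, (logKernel w z).toReal ∂μ ≤
        ∫ w, Real.circleAverage (fun x => regLog (regSeq n) (w - x)) z r ∂μ := by
      refine integral_mono_ae hi h1 (he.mono fun w hw => ?_)
      have hwz : w ≠ z := by
        rintro rfl
        simp [logKernel] at hw
      simpa [logKernel, hwz] using log_norm_le_circleAverage_regLog (regSeq_pos n) hwz hr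
    rw [h2, Real.circleAverage_def, intervalIntegral.integral_of_le Real.two_pi_pos.le,
      smul_eq_mul] at h3
    have h4 := mul_le_mul_of_nonneg_left (hc'.le.trans h3) Real.two_pi_pos.le
    rwa [← mul_assoc, mul_inv_cancel₀ (by positivity), one_mul] at h4

lemma IsCompactMeasure.isSubharmonic_pt (hμ : IsCompactMeasure μ) : IsSubharmonic (pt μ) where
  ne_top z := ne_top_of_le_ne_top (EReal.coe_ne_top _) (hμ.pt_le one_pos z)
  upperSemicontinuous := hμ.upperSemicontinuous_pt
  le_circleMean z _ hr := hμ.pt_le_circleMean z hr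

/-! ### Logarithmic potentials off the support and near infinity -/

lemma IsCompactMeasure.integrable_log_norm_sub (hμ : IsCompactMeasure μ) {z : ℂ}
    (hz : z ∉ μ.support) : Integrable (fun w => Real.log ‖w - z‖) μ := by
  refine hμ.integrable (ContinuousOn.log (by fun_prop) fun w hw => ?_)
  exact norm_ne_zero_iff.2 (sub_ne_zero.2 fun h => hz (h ▸ hw))

lemma IsCompactMeasure.pt_eq (hμ : IsCompactMeasure μ) {z : ℂ} (hz : z ∉ μ.support) :
    pt μ z = ((∫ w, Real.log ‖w - z‖ ∂μ : ℝ) : EReal) := by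
  rw [← eintegral_coe (hμ.integrable_log_norm_sub hz)]
  refine eintegral_congr (hμ.ae_mem_support.mono fun w hw => ?_)
  have : w ≠ z := fun h => hz (h ▸ hw)
  simp [logKernel, this]

lemma IsCompactMeasure.isProperSubharmonic_pt (hμ : IsCompactMeasure μ) :
    IsProperSubharmonic (pt μ) := by
  refine ⟨hμ.isSubharmonic_pt, ?_⟩
  obtain ⟨z, hz⟩ := (ne_univ_iff_exists_notMem _).1 hμ.isCompact_support.ne_univ
  exact ⟨z, by rw [hμ.pt_eq hz]; exact EReal.coe_ne_bot _⟩

/-- Near a point `z₀` off the support, the potential is a constant plus the real part of the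
holomorphic function `z ↦ ∫ log (1 - (z - z₀) / (w - z₀)) dμ w`. -/
lemma IsCompactMeasure.harmonicAt (hμ : IsCompactMeasure μ) {z₀ : ℂ} (hz₀ : z₀ ∉ μ.support) :
    InnerProductSpace.HarmonicAt (fun z => ∫ w, Real.log ‖w - z‖ ∂μ) z₀ := by
  have := hμ.isFiniteMeasure
  obtain ⟨ρ, hρ, hball⟩ := Metric.isOpen_iff.1 Measure.isOpen_compl_support z₀ hz₀
  have hdist : ∀ w ∈ μ.support, ρ ≤ ‖w - z₀‖ := by
    intro w hw
    by_contra! h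
    exact hball (mem_ball_iff_norm.2 h) hw
  have hne : ∀ w ∈ μ.support, w - z₀ ≠ 0 := fun w hw =>
    norm_pos_iff.1 (hρ.trans_le (hdist w hw))
  have hsmall : ∀ w ∈ μ.support, ∀ z ∈ Metric.ball z₀ (ρ / 2),
      ‖-((z - z₀) / (w - z₀))‖ ≤ 1 / 2 := by
    intro w hw z hz
    rw [norm_neg, norm_div, div_le_iff₀ (hρ.trans_le (hdist w hw))]
    linarith [mem_ball_iff_norm.1 hz, hdist w hw]
  have hslit : ∀ w ∈ μ.support, ∀ z ∈ Metric.ball z₀ (ρ / 2),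
      1 - (z - z₀) / (w - z₀) ∈ Complex.slitPlane := by
    intro w hw z hz
    rw [sub_eq_add_neg]
    exact Complex.mem_slitPlane_of_norm_lt_one ((hsmall w hw z hz).trans_lt (by norm_num))
  have hU : Metric.ball z₀ (ρ / 2) ∈ 𝓝 z₀ := Metric.ball_mem_nhds _ (by positivity)
  have hcont : ∀ z ∈ Metric.ball z₀ (ρ / 2),
      ContinuousOn (fun w => 1 - (z - z₀) / (w - z₀)) μ.support := fun z _ =>
    continuousOn_const.sub (continuousOn_const.div (by fun_prop) hne)
  have hint : ∀ z ∈ Metric.ball z₀ (ρ / 2),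
      Integrable (fun w => Complex.log (1 - (z - z₀) / (w - z₀))) μ := fun z hz =>
    hμ.integrable ((hcont z hz).clog fun w hw => hslit w hw z hz)
  have hderiv : ∀ z ∈ Metric.ball z₀ (ρ / 2), HasDerivAt
      (fun z => ∫ w, Complex.log (1 - (z - z₀) / (w - z₀)) ∂μ)
      (∫ w, (-(1 / (w - z₀))) / (1 - (z - z₀) / (w - z₀)) ∂μ) z := by
    intro z hz
    have hUz : Metric.ball z₀ (ρ / 2) ∈ 𝓝 z := Metric.isOpen_ball.mem_nhds hz
    refine (hasDerivAt_integral_of_dominated_loc_of_deriv_le (μ := μ)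
      (F := fun z w => Complex.log (1 - (z - z₀) / (w - z₀)))
      (F' := fun z w => (-(1 / (w - z₀))) / (1 - (z - z₀) / (w - z₀)))
      (bound := fun _ => 1 / ρ * 2) hUz ?_ (hint z hz) ?_ ?_ (integrable_const _) ?_).2
    · filter_upwards [hUz] with x hx using (hint x hx).aestronglyMeasurable
    · refine (hμ.integrable ?_).aestronglyMeasurable
      exact ((continuousOn_const.div (by fun_prop) hne).neg).div (hcont z hz)
        fun w hw => Complex.slitPlane_ne_zero (hslit w hw z hz)
    · filter_upwards [hμ.ae_mem_support] with w hw x hx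
      rw [norm_div, norm_neg, norm_div, norm_one, div_eq_mul_inv]
      have h1 : 1 / 2 ≤ ‖1 - (x - z₀) / (w - z₀)‖ := by
        have := norm_sub_norm_le (1 : ℂ) ((x - z₀) / (w - z₀))
        have h2 := hsmall w hw x hx
        rw [norm_neg] at h2
        rw [norm_one] at this
        linarith
      have h3 : ‖1 - (x - z₀) / (w - z₀)‖⁻¹ ≤ 2 := by
        rw [inv_le_comm₀ (by linarith) (by norm_num)]
        linarith
      have := hdist w hw
      gcongr
    · filter_upwards [hμ.ae_mem_support] with w hw x hx
      have h1 : HasDerivAt (fun z => 1 - (z - z₀) / (w - z₀)) (-(1 / (w - z₀))) x :=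
        (((hasDerivAt_id x).sub_const z₀).div_const (w - z₀)).const_sub 1
      exact h1.clog (hslit w hw x hx)
  have han : AnalyticAt ℂ (fun z => ∫ w, Complex.log (1 - (z - z₀) / (w - z₀)) ∂μ) z₀ :=
    DifferentiableOn.analyticAt
      (fun z hz => (hderiv z hz).differentiableAt.differentiableWithinAt) hU
  have hsum := (InnerProductSpace.harmonicAt_const (E := ℂ) (x := z₀)
    (∫ w, Real.log ‖w - z₀‖ ∂μ)).add han.harmonicAt_re
  refine (InnerProductSpace.harmonicAt_congr_nhds ?_).2 hsum
  filter_upwards [hU] with z hz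
  have hre := integral_re (hint z hz)
  simp only [RCLike.re_to_complex] at hre
  simp only [Pi.add_apply]
  have hire : Integrable (fun w => (Complex.log (1 - (z - z₀) / (w - z₀))).re) μ := (hint z hz).re
  rw [← hre, ← integral_add (hμ.integrable_log_norm_sub hz₀) hire]
  refine integral_congr_ae (hμ.ae_mem_support.mono fun w hw => ?_)
  simp only [Complex.log_re]
  rw [← Real.log_mul (norm_ne_zero_iff.2 (hne w hw))
    (norm_ne_zero_iff.2 (Complex.slitPlane_ne_zero (hslit w hw z hz))), ← norm_mul]
  congr 2
  have := hne w hw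
  field_simp
  ring

lemma IsCompactMeasure.isHarmonicNear_pt (hμ : IsCompactMeasure μ) :
    IsHarmonicNear (pt μ) (μ.support)ᶜ :=
  ⟨(μ.support)ᶜ, fun z => ∫ w, Real.log ‖w - z‖ ∂μ, Measure.isOpen_compl_support, subset_rfl,
    fun _ hz => hμ.harmonicAt hz, fun _ hz => hμ.pt_eq hz⟩

end Potential

end MonBalayage

namespace MonBalayage

section Decay

variable {μ δ ω : Measure ℂ} {p : ℝ≥0∞}

lemma IsCompactMeasure.integral_eq_of_isBalayage_mon (hδ : IsCompactMeasure δ)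
    (hω : IsCompactMeasure ω) (h : IsBalayage (mon p) ω δ) {k : ℕ} (hk : (k : ℝ≥0∞) ≤ p) (c : ℂ) :
    ∫ z, (c * z ^ k).re ∂ω = ∫ z, (c * z ^ k).re ∂δ := by
  have key : ∀ c : ℂ, ∫ z, (c * z ^ k).re ∂δ ≤ ∫ z, (c * z ^ k).re ∂ω := by
    intro c
    have hcont : Continuous fun z : ℂ => (c * z ^ k).re := by fun_prop
    have := (h _ ⟨k, c, hk, rfl⟩).2.2
    rw [eintegral_coe (hδ.integrable hcont.continuousOn),
      eintegral_coe (hω.integrable hcont.continuousOn)] at this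
    exact_mod_cast this
  refine le_antisymm ?_ (key c)
  have := key (-c)
  simp only [neg_mul, Complex.neg_re, integral_neg] at this
  linarith

lemma log_norm_sub_eq {w z : ℂ} (hz : z ≠ 0) (hwz : w ≠ z) :
    Real.log ‖w - z‖ = Real.log ‖z‖ + (Complex.log (1 + -(w / z))).re := by
  have h1 : w - z = -z * (1 + -(w / z)) := by field_simp; ring
  have h2 : (1 + -(w / z)) ≠ 0 := by
    intro h
    rw [h, mul_zero] at h1
    exact hwz (sub_eq_zero.1 h1)
  rw [Complex.log_re, ← Real.log_mul (norm_ne_zero_iff.2 hz) (norm_ne_zero_iff.2 h2), h1, norm_mul,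
    norm_neg]

/-- The multipole expansion of a potential near infinity, with an explicit remainder. -/
lemma IsCompactMeasure.abs_potential_sub_le (hμ : IsCompactMeasure μ) {R : ℝ} (hR : 0 < R)
    (hsupp : μ.support ⊆ Metric.closedBall 0 R) (n : ℕ) {z : ℂ} (hz : 2 * R ≤ ‖z‖) :
    |∫ w, Real.log ‖w - z‖ ∂μ - (μ.real univ * Real.log ‖z‖ +
      ∫ w, (Complex.logTaylor (n + 1) (-(w / z))).re ∂μ)| ≤
      2 * μ.real univ * (R / ‖z‖) ^ (n + 1) := by
  have := hμ.isFiniteMeasure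
  have hz0 : z ≠ 0 := norm_pos_iff.1 (by linarith)
  have hn : ∀ w ∈ μ.support, ‖w‖ ≤ R := fun w hw => mem_closedBall_zero_iff.1 (hsupp hw)
  have hzs : z ∉ μ.support := fun h => by linarith [hn z h]
  have hcT : Continuous fun w : ℂ => (Complex.logTaylor (n + 1) (-(w / z))).re := by
    unfold Complex.logTaylor
    fun_prop
  have hiT := hμ.integrable hcT.continuousOn
  have hi := hμ.integrable_log_norm_sub hzs
  have e : ∫ w, Real.log ‖w - z‖ ∂μ - (μ.real univ * Real.log ‖z‖ +
      ∫ w, (Complex.logTaylor (n + 1) (-(w / z))).re ∂μ) =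
      ∫ w, (Real.log ‖w - z‖ - (Real.log ‖z‖ +
        (Complex.logTaylor (n + 1) (-(w / z))).re)) ∂μ := by
    have hiS : Integrable (fun w => Real.log ‖z‖ +
        (Complex.logTaylor (n + 1) (-(w / z))).re) μ := (integrable_const _).add hiT
    rw [integral_sub hi hiS, integral_add (integrable_const _) hiT,
      integral_const, smul_eq_mul]
  rw [e, ← Real.norm_eq_abs]
  refine (norm_integral_le_of_norm_le_const (C := 2 * (R / ‖z‖) ^ (n + 1)) ?_).trans_eq (by ring)
  filter_upwards [hμ.ae_mem_support] with w hw
  have hq : ‖-(w / z)‖ ≤ R / ‖z‖ := by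
    rw [norm_neg, norm_div]
    gcongr
    exact hn w hw
  have hh : R / ‖z‖ ≤ 1 / 2 := by
    rw [div_le_iff₀ (by linarith)]
    linarith
  have hlt : ‖-(w / z)‖ < 1 := by linarith
  rw [log_norm_sub_eq hz0 fun h => hzs (h ▸ hw), add_sub_add_left_eq_sub, ← Complex.sub_re,
    Real.norm_eq_abs]
  refine (Complex.abs_re_le_norm _).trans ((Complex.norm_log_sub_logTaylor_le n hlt).trans ?_)
  have h1 : (1 - ‖-(w / z)‖)⁻¹ ≤ 2 := by
    rw [inv_le_comm₀ (by linarith) (by norm_num)]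
    linarith
  calc ‖-(w / z)‖ ^ (n + 1) * (1 - ‖-(w / z)‖)⁻¹ / (n + 1)
      ≤ ‖-(w / z)‖ ^ (n + 1) * (1 - ‖-(w / z)‖)⁻¹ :=
        div_le_self (mul_nonneg (by positivity) (inv_nonneg.2 (by linarith)))
          (by have := Nat.cast_nonneg (α := ℝ) n; linarith)
    _ ≤ (R / ‖z‖) ^ (n + 1) * 2 := by gcongr
    _ = _ := by ring

lemma integral_logTaylor_eq (hδ : IsCompactMeasure δ) (hω : IsCompactMeasure ω)
    (h : IsBalayage (mon p) ω δ) {n : ℕ} (hn : (n : ℝ≥0∞) ≤ p) (z : ℂ) :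
    ∫ w, (Complex.logTaylor (n + 1) (-(w / z))).re ∂ω =
      ∫ w, (Complex.logTaylor (n + 1) (-(w / z))).re ∂δ := by
  have e : ∀ w : ℂ, (Complex.logTaylor (n + 1) (-(w / z))).re =
      ∑ j ∈ Finset.range (n + 1), (((-1) ^ (j + 1) * (-z⁻¹) ^ j / j) * w ^ j).re := by
    intro w
    rw [Complex.logTaylor, Complex.re_sum]
    refine Finset.sum_congr rfl fun j _ => ?_
    congr 1
    have : -(w / z) = (-z⁻¹) * w := by rw [div_eq_mul_inv]; ring
    rw [this, mul_pow]
    ring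
  have hcont : ∀ j : ℕ, Continuous fun w : ℂ =>
      (((-1) ^ (j + 1) * (-z⁻¹) ^ j / j) * w ^ j).re := fun j => by fun_prop
  simp only [e]
  rw [integral_finsetSum _ fun j _ => hω.integrable (hcont j).continuousOn,
    integral_finsetSum _ fun j _ => hδ.integrable (hcont j).continuousOn]
  refine Finset.sum_congr rfl fun j hj => ?_
  refine hδ.integral_eq_of_isBalayage_mon hω h (le_trans ?_ hn) _
  exact_mod_cast Finset.mem_range_succ_iff.1 hj

lemma measureReal_univ_eq (hδ : IsCompactMeasure δ) (hω : IsCompactMeasure ω)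
    (h : IsBalayage (mon p) ω δ) : ω.real univ = δ.real univ := by
  simpa using hδ.integral_eq_of_isBalayage_mon hω h (k := 0) (by simp) 1

/-- Measures with the same moments of order at most `n` have potentials that agree up to
`O (‖z‖ ^ (-n - 1))`. -/
lemma abs_potential_sub_potential_le (hδ : IsCompactMeasure δ) (hω : IsCompactMeasure ω)
    (h : IsBalayage (mon p) ω δ) {R : ℝ} (hR : 0 < R)
    (hδR : δ.support ⊆ Metric.closedBall 0 R) (hωR : ω.support ⊆ Metric.closedBall 0 R)
    {n : ℕ} (hn : (n : ℝ≥0∞) ≤ p) {z : ℂ} (hz : 2 * R ≤ ‖z‖) :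
    |(pt ω z).toReal - (pt δ z).toReal| ≤ 4 * δ.real univ * (R / ‖z‖) ^ (n + 1) := by
  have hzn : ∀ {μ : Measure ℂ}, μ.support ⊆ Metric.closedBall 0 R → z ∉ μ.support :=
    fun hs hh => by linarith [mem_closedBall_zero_iff.1 (hs hh)]
  rw [hω.pt_eq (hzn hωR), hδ.pt_eq (hzn hδR), EReal.toReal_coe, EReal.toReal_coe]
  have h1 := hδ.abs_potential_sub_le hR hδR n hz
  have h2 := hω.abs_potential_sub_le hR hωR n hz
  rw [integral_logTaylor_eq hδ hω h hn, measureReal_univ_eq hδ hω h] at h2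
  rw [abs_le] at h1 h2 ⊢
  constructor <;> linarith

lemma natFloor_toReal_le (hp : p ≠ ⊤) : ((⌊p.toReal⌋₊ : ℕ) : ℝ≥0∞) ≤ p := by
  rw [← ENNReal.ofReal_natCast]
  exact (ENNReal.ofReal_le_ofReal (Nat.floor_le ENNReal.toReal_nonneg)).trans_eq
    (ENNReal.ofReal_toReal hp)

lemma le_natFloor_toReal (hp : p ≠ ⊤) {k : ℕ} (hk : (k : ℝ≥0∞) ≤ p) : k ≤ ⌊p.toReal⌋₊ := by
  refine Nat.le_floor ?_
  simpa using ENNReal.toReal_mono hp hk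

lemma eqUpToDecay_pt (hδ : IsCompactMeasure δ) (hω : IsCompactMeasure ω)
    (h : IsBalayage (mon p) ω δ) : EqUpToDecay p (pt ω) (pt δ) := by
  have := hδ.isFiniteMeasure
  obtain ⟨R, hR, hsub⟩ :=
    (hδ.isCompact_support.union hω.isCompact_support).isBounded.subset_closedBall_lt 0 0
  obtain ⟨hδR, hωR⟩ := union_subset_iff.1 hsub
  have hev : ∀ᶠ z : ℂ in Bornology.cobounded ℂ, 2 * R ≤ ‖z‖ :=
    tendsto_norm_cobounded_atTop.eventually_ge_atTop _
  constructor
  · filter_upwards [hev] with z hz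
    have hzn : ∀ {μ : Measure ℂ}, μ.support ⊆ Metric.closedBall 0 R → z ∉ μ.support :=
      fun hs hh => by linarith [mem_closedBall_zero_iff.1 (hs hh)]
    rw [hω.pt_eq (hzn hωR), hδ.pt_eq (hzn hδR)]
    exact ⟨⟨EReal.coe_ne_bot _, EReal.coe_ne_top _⟩, EReal.coe_ne_bot _, EReal.coe_ne_top _⟩
  · by_cases hp : p = ⊤
    · -- The bound holds for all `n`, hence the difference vanishes.
      refine Asymptotics.IsBigO.of_bound 0 ?_
      filter_upwards [hev] with z hz
      rw [zero_mul, Real.norm_eq_abs]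
      have hq : R / ‖z‖ < 1 := by
        rw [div_lt_one (by linarith)]
        linarith
      have ht : Tendsto (fun n : ℕ => 4 * δ.real univ * (R / ‖z‖) ^ (n + 1)) atTop (𝓝 0) := by
        have := ((tendsto_pow_atTop_nhds_zero_of_lt_one (by positivity) hq).comp
          (tendsto_add_atTop_nat 1)).const_mul (4 * δ.real univ)
        simpa using this
      exact ge_of_tendsto' ht fun n =>
        abs_potential_sub_potential_le hδ hω h hR hδR hωR (by simp [hp]) hz
    · refine Asymptotics.IsBigO.of_bound (4 * δ.real univ * R ^ (⌊p.toReal⌋₊ + 1)) ?_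
      filter_upwards [hev] with z hz
      have := abs_potential_sub_potential_le hδ hω h hR hδR hωR (natFloor_toReal_le hp) hz
      rw [Real.norm_eq_abs, decayRate, if_neg hp, Real.norm_eq_abs,
        abs_of_nonneg (by positivity : (0 : ℝ) ≤ 1 / ‖z‖ ^ (⌊p.toReal⌋₊ + 1))]
      refine this.trans_eq ?_
      rw [div_pow]
      ring

end Decay

end MonBalayage

namespace MonBalayage

/-! ### Circle averages and the Laplacian of smooth functions -/

section Calculus

lemma iteratedDeriv_comp_line {f : ℂ → ℝ} {k : ℕ} (hf : ContDiff ℝ k f) (z e : ℂ) (t : ℝ) :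
    iteratedDeriv k (fun t : ℝ => f (z + t • e)) t =
      iteratedFDeriv ℝ k f (z + t • e) fun _ => e := by
  have h1 : (fun t : ℝ => f (z + t • e)) =
      (fun x => f (z + x)) ∘ (ContinuousLinearMap.toSpanSingleton ℝ e) := by
    ext t; simp
  rw [iteratedDeriv_eq_iteratedFDeriv, h1, ContinuousLinearMap.iteratedFDeriv_comp_right
    (n := (k : WithTop ℕ∞)) _ (by fun_prop) _ le_rfl, iteratedFDeriv_comp_add_left]
  simp

lemma laplacian_eq_iteratedDeriv_lines {f : ℂ → ℝ} (hf : ContDiff ℝ 2 f) (z : ℂ) :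
    (Δ f) z = iteratedDeriv 2 (fun t : ℝ => f (z + t • (1 : ℂ))) 0 +
      iteratedDeriv 2 (fun t : ℝ => f (z + t • Complex.I)) 0 := by
  rw [InnerProductSpace.laplacian_eq_iteratedFDeriv_complexPlane,
    iteratedDeriv_comp_line (k := 2) (by exact_mod_cast hf),
    iteratedDeriv_comp_line (k := 2) (by exact_mod_cast hf)]
  simp only [zero_smul, add_zero]
  congr 2 <;> ext i <;> fin_cases i <;> rfl

/-- The Laplacian can be computed in any rotated orthonormal frame. -/
lemma iteratedFDeriv_two_add_rotate (f : ℂ → ℝ) (z e : ℂ) :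
    (iteratedFDeriv ℝ 2 f z fun _ => e) + (iteratedFDeriv ℝ 2 f z fun _ => Complex.I * e) =
      ‖e‖ ^ 2 * (Δ f) z := by
  have h1 : e = e.re • (1 : ℂ) + e.im • Complex.I := by
    apply Complex.ext <;> simp
  have h2 : Complex.I * e = -e.im • (1 : ℂ) + e.re • Complex.I := by
    apply Complex.ext <;> simp
  rw [InnerProductSpace.laplacian_eq_iteratedFDeriv_complexPlane]
  simp only [iteratedFDeriv_two_apply]
  rw [h2, ← Complex.normSq_eq_norm_sq, Complex.normSq_apply]
  generalize fderiv ℝ (fderiv ℝ f) z = B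
  conv_lhs => rw [h1]
  simp only [map_add, map_smul, add_apply, smul_apply, smul_eq_mul, Matrix.cons_val_zero,
    Matrix.cons_val_one]
  simp
  ring

lemma abs_symm_second_difference_le {g : ℝ → ℝ} (hg : ContDiff ℝ 3 g) {B : ℝ}
    (hB : ∀ t, |iteratedDeriv 3 g t| ≤ B) {t : ℝ} (ht : 0 < t) :
    |g t + g (-t) - 2 * g 0 - t ^ 2 * iteratedDeriv 2 g 0| ≤ B * t ^ 3 := by
  have key : ∀ s : ℝ, s ≠ 0 → ∃ ξ, g s - (g 0 + s * iteratedDeriv 1 g 0 +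
      s ^ 2 / 2 * iteratedDeriv 2 g 0) = iteratedDeriv 3 g ξ * s ^ 3 / 6 := by
    intro s hs
    obtain ⟨ξ, -, hξ⟩ := taylor_mean_remainder_lagrange_iteratedDeriv (f := g) (x₀ := 0) (x := s)
      (n := 2) hs.symm (by norm_num; exact hg.contDiffOn)
    refine ⟨ξ, ?_⟩
    have hw : ∀ k : ℕ, k ≤ 3 → iteratedDerivWithin k g (uIcc 0 s) 0 = iteratedDeriv k g 0 :=
      fun k hk => iteratedDerivWithin_eq_iteratedDeriv (uniqueDiffOn_uIcc hs.symm)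
        (hg.of_le (by exact_mod_cast hk)).contDiffAt left_mem_uIcc
    rw [taylor_within_apply, Finset.sum_range_succ, Finset.sum_range_succ, Finset.sum_range_one,
      hw 0 (by norm_num), hw 1 (by norm_num), hw 2 (by norm_num)] at hξ
    simp only [iteratedDeriv_zero, sub_zero, smul_eq_mul] at hξ
    norm_num [Nat.factorial] at hξ ⊢
    linarith
  obtain ⟨ξ, h1⟩ := key t ht.ne'
  obtain ⟨η, h2⟩ := key (-t) (neg_ne_zero.2 ht.ne')
  have e : g t + g (-t) - 2 * g 0 - t ^ 2 * iteratedDeriv 2 g 0 =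
      (iteratedDeriv 3 g ξ - iteratedDeriv 3 g η) * t ^ 3 / 6 := by linarith
  have hx := abs_le.1 (hB ξ)
  have hy := abs_le.1 (hB η)
  have h3 : 0 < t ^ 3 := by positivity
  rw [e, abs_le]
  constructor <;> nlinarith

lemma abs_cross_difference_le {f : ℂ → ℝ} (hf : ContDiff ℝ 3 f) {B : ℝ}
    (hB : ∀ z, ‖iteratedFDeriv ℝ 3 f z‖ ≤ B) (z : ℂ) {e : ℂ} (he : ‖e‖ = 1) {r : ℝ} (hr : 0 < r) :
    |f (z + r • e) + f (z - r • e) + f (z + r • (Complex.I * e)) + f (z - r • (Complex.I * e)) -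
      4 * f z - r ^ 2 * (Δ f) z| ≤ 2 * B * r ^ 3 := by
  have key : ∀ e : ℂ, ‖e‖ = 1 → |f (z + r • e) + f (z - r • e) - 2 * f z -
      r ^ 2 * iteratedFDeriv ℝ 2 f z fun _ => e| ≤ B * r ^ 3 := by
    intro e he
    have hg : ContDiff ℝ 3 fun t : ℝ => f (z + t • e) := by fun_prop
    have := abs_symm_second_difference_le hg (B := B) (fun t => ?_) hr
    · rw [iteratedDeriv_comp_line (k := 2) (hf.of_le (by norm_num))] at this
      simpa [sub_eq_add_neg] using this
    · rw [iteratedDeriv_comp_line (k := 3) hf]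
      have := (iteratedFDeriv ℝ 3 f (z + t • e)).le_opNorm fun _ => e
      simp only [he, Finset.prod_const_one, mul_one] at this
      exact this.trans (hB _)
  have h1 := abs_le.1 (key e he)
  have h2 := abs_le.1 (key (Complex.I * e) (by simp [he]))
  have h3 := iteratedFDeriv_two_add_rotate f z e
  rw [he, one_pow, one_mul] at h3
  rw [← h3, abs_le]
  constructor <;> linarith

/-- The Laplacian is the second order term of the circle average. -/
lemma abs_circleAverage_sub_le {f : ℂ → ℝ} (hf : ContDiff ℝ 3 f) {B : ℝ}
    (hB : ∀ z, ‖iteratedFDeriv ℝ 3 f z‖ ≤ B) (z : ℂ) {r : ℝ} (hr : 0 < r) :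
    |Real.circleAverage f z r - f z - r ^ 2 / 4 * (Δ f) z| ≤ B * r ^ 3 := by
  have hi : ∀ η, IntervalIntegrable (fun θ => f (circleMap z r (θ + η))) volume 0 (2 * Real.pi) :=
    fun η => Continuous.intervalIntegrable (hf.continuous.comp
      ((continuous_circleMap z r).comp (continuous_add_const η))) _ _
  -- The average is unchanged when the four points of a rotated cross are averaged first.
  have e1 : 4 * Real.circleAverage f z r = (2 * Real.pi)⁻¹ * ∫ θ in 0..2 * Real.pi,
      (f (circleMap z r (θ + 0)) + f (circleMap z r (θ + Real.pi)) +
        f (circleMap z r (θ + Real.pi / 2)) + f (circleMap z r (θ + -(Real.pi / 2)))) := by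
    rw [intervalIntegral.integral_add (((hi _).add (hi _)).add (hi _)) (hi _),
      intervalIntegral.integral_add ((hi _).add (hi _)) (hi _),
      intervalIntegral.integral_add (hi _) (hi _)]
    have hA : ∀ η, (2 * Real.pi)⁻¹ * ∫ θ in 0..2 * Real.pi, f (circleMap z r (θ + η)) =
        Real.circleAverage f z r := fun η => (Real.circleAverage_eq_integral_add η).symm
    rw [mul_add, mul_add, mul_add, hA, hA, hA, hA]
    ring
  have e2 : 4 * (Real.circleAverage f z r - f z - r ^ 2 / 4 * (Δ f) z) =
      (2 * Real.pi)⁻¹ * ∫ θ in 0..2 * Real.pi,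
      (f (circleMap z r (θ + 0)) + f (circleMap z r (θ + Real.pi)) +
        f (circleMap z r (θ + Real.pi / 2)) + f (circleMap z r (θ + -(Real.pi / 2))) -
        (4 * f z + r ^ 2 * (Δ f) z)) := by
    rw [intervalIntegral.integral_sub ((((hi _).add (hi _)).add (hi _)).add (hi _))
      intervalIntegrable_const, mul_sub (2 * Real.pi)⁻¹, ← e1,
      intervalIntegral.integral_const, sub_zero,
      smul_eq_mul, inv_mul_cancel_left₀ (by positivity)]
    ring
  have e3 := intervalIntegral.norm_integral_le_of_norm_le_const (a := 0) (b := 2 * Real.pi)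
    (C := 2 * B * r ^ 3)
    (f := fun θ => f (circleMap z r (θ + 0)) + f (circleMap z r (θ + Real.pi)) +
        f (circleMap z r (θ + Real.pi / 2)) + f (circleMap z r (θ + -(Real.pi / 2))) -
        (4 * f z + r ^ 2 * (Δ f) z)) (fun θ _ => by
      have := abs_cross_difference_le hf hB z (e := Complex.exp (θ * Complex.I))
        (Complex.norm_exp_ofReal_mul_I θ) hr
      rw [Real.norm_eq_abs]
      convert this using 2
      simp only [circleMap, Complex.real_smul, Complex.ofReal_add, add_mul, Complex.exp_add,
        Complex.ofReal_neg, neg_mul, Complex.exp_neg, Complex.exp_pi_mul_I, Complex.ofReal_div,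
        Complex.ofReal_ofNat, Complex.exp_pi_div_two_mul_I, Complex.ofReal_zero, zero_mul,
        Complex.exp_zero, mul_one, Complex.inv_I]
      rw [show z + r * (Complex.exp (θ * Complex.I) * -1) =
          z - r * Complex.exp (θ * Complex.I) by ring,
        show z + r * (Complex.exp (θ * Complex.I) * Complex.I) =
          z + r * (Complex.I * Complex.exp (θ * Complex.I)) by ring,
        show z + r * (Complex.exp (θ * Complex.I) * -Complex.I) =
          z - r * (Complex.I * Complex.exp (θ * Complex.I)) by ring]
      ring)
  rw [Real.norm_eq_abs, sub_zero, abs_of_pos Real.two_pi_pos] at e3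
  have e4 : |4 * (Real.circleAverage f z r - f z - r ^ 2 / 4 * (Δ f) z)| ≤ 2 * B * r ^ 3 := by
    rw [e2, abs_mul, abs_of_pos (inv_pos.2 Real.two_pi_pos)]
    refine (mul_le_mul_of_nonneg_left e3 (inv_pos.2 Real.two_pi_pos).le).trans_eq ?_
    field_simp
  have hB0 : 0 ≤ B * r ^ 3 := mul_nonneg ((norm_nonneg _).trans (hB z)) (by positivity)
  rw [abs_mul, abs_of_pos (by norm_num : (0 : ℝ) < 4)] at e4
  linarith

end Calculus

end MonBalayage

namespace MonBalayage

/-! ### Circle averages and the distributional Laplacian -/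

section Distribution

variable {u φ : ℂ → ℝ}

/-- Circle averaging is symmetric with respect to the integral pairing. -/
lemma integral_mul_circleAverage (hu : LocallyIntegrable u) (hφ : Continuous φ)
    (hs : HasCompactSupport φ) (r : ℝ) :
    Integrable (fun z => φ z * Real.circleAverage u z r) ∧
    Integrable (fun z => u z * Real.circleAverage φ z r) ∧
    ∫ z, φ z * Real.circleAverage u z r = ∫ z, u z * Real.circleAverage φ z r := by
  set ν : Measure ℝ := volume.restrict (Ioc (0 : ℝ) (2 * Real.pi)) with hν
  obtain ⟨C, hC⟩ := hφ.bounded_above_of_compact_support hs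
  obtain ⟨A, hA⟩ := hs.isCompact.isBounded.subset_closedBall 0
  have hshift : ∀ (θ : ℝ) (z : ℂ), circleMap z (-r) θ + circleMap 0 r θ = z := by
    intro θ z
    simp [circleMap]
  have hG : Integrable (fun q : ℝ × ℂ => φ (circleMap q.2 (-r) q.1) * u q.2) (ν.prod volume) := by
    have h1 : Integrable ((Metric.closedBall (0 : ℂ) (A + |r|)).indicator u) volume :=
      (hu.integrableOn_isCompact (isCompact_closedBall _ _)).integrable_indicator
        measurableSet_closedBall
    refine ((h1.comp_snd ν).bdd_mul (c := C) (f := fun q : ℝ × ℂ => φ (circleMap q.2 (-r) q.1))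
      ?_ (ae_of_all _ fun q => hC _)).congr (ae_of_all _ fun q => ?_)
    · refine Continuous.aestronglyMeasurable (hφ.comp ?_)
      unfold circleMap
      fun_prop
    · simp only
      by_cases hq : q.2 ∈ Metric.closedBall (0 : ℂ) (A + |r|)
      · rw [indicator_of_mem hq]
      · rw [indicator_of_notMem hq, mul_zero]
        have : circleMap q.2 (-r) q.1 ∉ tsupport φ := by
          intro hmem
          apply hq
          have h2 := mem_closedBall_zero_iff.1 (hA hmem)
          rw [mem_closedBall_zero_iff, ← hshift q.1 q.2]
          refine (norm_add_le _ _).trans (add_le_add h2 ?_)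
          simp
        rw [image_eq_zero_of_notMem_tsupport this, zero_mul]
  have hmp : MeasurePreserving (fun q : ℝ × ℂ => (q.1, q.2 + circleMap 0 r q.1))
      (ν.prod volume) (ν.prod volume) := by
    refine (MeasurePreserving.id ν).skew_product (g := fun θ z => z + circleMap 0 r θ) ?_ ?_
    · exact Continuous.measurable (by unfold circleMap Function.uncurry; fun_prop)
    · exact ae_of_all _ fun θ => map_add_right_eq_self volume _
  have hF : Integrable (fun q : ℝ × ℂ => φ q.2 * u (circleMap q.2 r q.1)) (ν.prod volume) := by
    refine ((hmp.integrable_comp hG.aestronglyMeasurable).2 hG).congr (ae_of_all _ fun q => ?_)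
    simp [circleMap]
  have e1 : (fun z => φ z * Real.circleAverage u z r) = fun z =>
      (2 * Real.pi)⁻¹ * ∫ θ, φ z * u (circleMap z r θ) ∂ν := by
    funext z
    rw [Real.circleAverage_def, intervalIntegral.integral_of_le Real.two_pi_pos.le, smul_eq_mul,
      integral_const_mul]
    ring
  have e2 : (fun z => u z * Real.circleAverage φ z r) = fun z =>
      (2 * Real.pi)⁻¹ * ∫ θ, φ (circleMap z (-r) θ) * u z ∂ν := by
    funext z
    rw [← Real.circleAverage_neg_radius, Real.circleAverage_def,
      intervalIntegral.integral_of_le Real.two_pi_pos.le, smul_eq_mul, integral_mul_const]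
    ring
  rw [e1, e2]
  refine ⟨hF.integral_prod_right.const_mul _, hG.integral_prod_right.const_mul _, ?_⟩
  rw [integral_const_mul, integral_const_mul]
  congr 1
  rw [← integral_integral_swap (f := fun θ z => φ z * u (circleMap z r θ)) hF,
    ← integral_integral_swap (f := fun θ z => φ (circleMap z (-r) θ) * u z) hG]
  congr 1
  funext θ
  rw [← integral_add_right_eq_self (μ := volume)
    (fun z => φ (circleMap z (-r) θ) * u z) (circleMap 0 r θ)]
  refine integral_congr_ae (ae_of_all _ fun z => ?_)
  simp [circleMap]

lemma laplacian_eq_zero_of_notMem_tsupport {z : ℂ} (hz : z ∉ tsupport φ) : (Δ φ) z = 0 := by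
  have h := notMem_tsupport_iff_eventuallyEq.1 hz
  rw [(InnerProductSpace.laplacian_congr_nhds h).eq_of_nhds]
  exact congrFun InnerProductSpace.laplacian_const z

lemma hasCompactSupport_laplacian (hs : HasCompactSupport φ) : HasCompactSupport (Δ φ) :=
  HasCompactSupport.intro hs fun _ hz => laplacian_eq_zero_of_notMem_tsupport hz

lemma continuous_laplacian (hφ : ContDiff ℝ 2 φ) : Continuous (Δ φ) := by
  rw [InnerProductSpace.laplacian_eq_iteratedFDeriv_complexPlane]
  have h := hφ.continuous_iteratedFDeriv (m := 2) le_rfl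
  fun_prop

lemma integrable_mul_laplacian (hu : LocallyIntegrable u) (hφ : ContDiff ℝ 2 φ)
    (hs : HasCompactSupport φ) : Integrable fun z => u z * (Δ φ) z :=
  hu.integrable_smul_right_of_hasCompactSupport (continuous_laplacian hφ)
    (hasCompactSupport_laplacian hs)

/-- If the circle averages of `u` dominate `u` weakly against `φ`, then so does the distributional
Laplacian. No sign of `φ` is assumed. -/
lemma integral_mul_laplacian_nonneg (hu : LocallyIntegrable u) (hφ : ContDiff ℝ 3 φ)
    (hs : HasCompactSupport φ)
    (h : ∀ᶠ r in 𝓝[>] (0 : ℝ), ∫ z, φ z * u z ≤ ∫ z, φ z * Real.circleAverage u z r) :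
    0 ≤ ∫ z, u z * (Δ φ) z := by
  obtain ⟨B, hB⟩ := (hφ.continuous_iteratedFDeriv (m := 3) le_rfl).bounded_above_of_compact_support
    (hs.iteratedFDeriv 3)
  obtain ⟨A, hA⟩ := hs.isCompact.isBounded.subset_closedBall 0
  set K := Metric.closedBall (0 : ℂ) (A + 1) with hK
  set I := ∫ z in K, |u z| with hI
  have huK : IntegrableOn u K := hu.integrableOn_isCompact (isCompact_closedBall _ _)
  have key : ∀ᶠ r in 𝓝[>] (0 : ℝ), -(4 * (B * I)) * r ≤ ∫ z, u z * (Δ φ) z := by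
    filter_upwards [h, Ioc_mem_nhdsGT one_pos] with r hr hr1
    obtain ⟨-, h2, h3⟩ := integral_mul_circleAverage hu hφ.continuous hs r
    have h4 : Integrable fun z => u z * φ z :=
      hu.integrable_smul_right_of_hasCompactSupport hφ.continuous hs
    have h5 := integrable_mul_laplacian hu (hφ.of_le (by norm_num)) hs
    have h6 : |∫ z, (u z * Real.circleAverage φ z r - u z * φ z - r ^ 2 / 4 * (u z * (Δ φ) z))| ≤
        B * r ^ 3 * I := by
      have hbd : ∀ z, ‖u z * Real.circleAverage φ z r - u z * φ z -
          r ^ 2 / 4 * (u z * (Δ φ) z)‖ ≤ K.indicator (fun z => B * r ^ 3 * |u z|) z := by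
        intro z
        have e : u z * Real.circleAverage φ z r - u z * φ z - r ^ 2 / 4 * (u z * (Δ φ) z) =
          (Real.circleAverage φ z r - φ z - r ^ 2 / 4 * (Δ φ) z) * u z := by ring
        rw [e]
        by_cases hz : z ∈ K
        · rw [indicator_of_mem hz, norm_mul]
          exact mul_le_mul_of_nonneg_right (abs_circleAverage_sub_le hφ hB z hr1.1)
            (abs_nonneg _)
        · have hout : ∀ w : ℂ, ‖w - z‖ ≤ 1 → w ∉ tsupport φ := by
            intro w hw hmem
            apply hz
            have := mem_closedBall_zero_iff.1 (hA hmem)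
            rw [hK, mem_closedBall_zero_iff]
            have h7 := norm_sub_norm_le z w
            rw [norm_sub_rev] at h7
            linarith
          have hzt : z ∉ tsupport φ := hout z (by simp)
          have hav : Real.circleAverage φ z r = 0 := by
            rw [Real.circleAverage_def]
            have : ∀ θ, φ (circleMap z r θ) = 0 := fun θ =>
              image_eq_zero_of_notMem_tsupport (hout _ (by
                rw [circleMap_sub_center, norm_circleMap_zero, abs_of_pos hr1.1]
                exact hr1.2))
            simp [this]
          rw [hav, image_eq_zero_of_notMem_tsupport hzt, laplacian_eq_zero_of_notMem_tsupport hzt,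
            indicator_of_notMem hz]
          simp
      have := norm_integral_le_of_norm_le (IntegrableOn.integrable_indicator
        (huK.abs.const_mul (B * r ^ 3)) measurableSet_closedBall) (ae_of_all _ hbd)
      rwa [integral_indicator measurableSet_closedBall, integral_const_mul] at this
    have h24 : Integrable fun z => u z * Real.circleAverage φ z r - u z * φ z := h2.sub h4
    rw [integral_sub h24 (h5.const_mul _), integral_sub h2 h4, integral_const_mul,
      ← h3] at h6
    have h7 := (abs_le.1 h6).2
    have h8 : ∫ z, u z * φ z = ∫ z, φ z * u z := by simp only [mul_comm]
    rw [h8] at h7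
    have hr0 := hr1.1
    have h9 : -(B * r ^ 3 * I) ≤ r ^ 2 / 4 * ∫ z, u z * (Δ φ) z := by linarith
    have h10 : 0 < r ^ 2 / 4 := by positivity
    refine le_of_mul_le_mul_left ?_ h10
    refine le_trans (le_of_eq ?_) h9
    ring
  have hlim : Tendsto (fun r : ℝ => -(4 * (B * I)) * r) (𝓝[>] 0) (𝓝 0) := by
    have : Tendsto (fun r : ℝ => -(4 * (B * I)) * r) (𝓝 0) (𝓝 (-(4 * (B * I)) * 0)) :=
      tendsto_id.const_mul _
    rw [mul_zero] at this
    exact this.mono_left nhdsWithin_le_nhds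
  exact le_of_tendsto hlim key

end Distribution

end MonBalayage

namespace MonBalayage

/-! ### Local integrability of subharmonic functions -/

section Subharmonic

variable {u : ℂ → EReal}

lemma IsSubharmonic.measurable (hu : IsSubharmonic u) : Measurable u :=
  hu.upperSemicontinuous.measurable

lemma IsSubharmonic.exists_le_of_isCompact (hu : IsSubharmonic u) {K : Set ℂ} (hK : IsCompact K) :
    ∃ M : ℝ, 0 ≤ M ∧ ∀ z ∈ K, u z ≤ (M : EReal) := by
  rcases K.eq_empty_or_nonempty with rfl | hne
  · exact ⟨0, le_rfl, by simp⟩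
  obtain ⟨a, -, ha⟩ := (hu.upperSemicontinuous.upperSemicontinuousOn K).exists_isMaxOn hne hK
  refine ⟨max (u a).toReal 0, le_max_right _ _, fun z hz => ?_⟩
  refine (ha hz).trans ((EReal.le_coe_toReal (hu.ne_top a)).trans ?_)
  exact_mod_cast le_max_left _ _

lemma lintegral_toENNReal_ne_top_of_le {X : Type*} [MeasurableSpace X] {μ : Measure X}
    [IsFiniteMeasure μ] {h : X → EReal} {M : ℝ} (hM : ∀ᵐ x ∂μ, h x ≤ (M : EReal)) :
    ∫⁻ x, (h x).toENNReal ∂μ ≠ ⊤ :=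
  ne_top_of_le_ne_top (lintegral_toENNReal_coe_ne_top (integrable_const M))
    (lintegral_mono_ae (hM.mono fun _ hx => EReal.toENNReal_le_toENNReal hx))

/-- On a circle around a point where it is finite, a subharmonic function is integrable and almost
everywhere finite, so that the sub-mean value inequality can be read in the real numbers. -/
lemma IsSubharmonic.circle (hu : IsSubharmonic u) {z : ℂ} (hz : u z ≠ ⊥) {r : ℝ} (hr : 0 < r) :
    IntegrableOn (fun θ => (u (circleMap z r θ)).toReal) (Ioc 0 (2 * Real.pi)) ∧
    (∀ᵐ θ ∂volume.restrict (Ioc 0 (2 * Real.pi)),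
      u (circleMap z r θ) = ((u (circleMap z r θ)).toReal : EReal)) ∧
    (u z).toReal ≤ Real.circleAverage (fun w => (u w).toReal) z r := by
  obtain ⟨M, -, hM⟩ := hu.exists_le_of_isCompact (isCompact_sphere z r)
  have hle := hu.le_circleMean z r hr
  have hne : eintegral (volume.restrict (Ioc 0 (2 * Real.pi))) (fun θ => u (circleMap z r θ)) ≠
      ⊥ := by
    intro h
    rw [circleMean, h, EReal.coe_mul_bot_of_pos (by positivity)] at hle
    exact hz (le_bot_iff.1 hle)
  obtain ⟨h1, h2, h3⟩ := integrable_toReal_of_eintegral_ne_bot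
    (h := fun θ => u (circleMap z r θ))
    (hu.measurable.comp (continuous_circleMap z r).measurable).aemeasurable
    (lintegral_toENNReal_ne_top_of_le (M := M)
      (ae_of_all _ fun θ => hM _ (circleMap_mem_sphere z hr.le θ))) hne
  refine ⟨h1, h2, ?_⟩
  rw [circleMean, h3, ← EReal.coe_mul, ← EReal.coe_toReal (hu.ne_top z) hz,
    EReal.coe_le_coe_iff] at hle
  rwa [Real.circleAverage_def, intervalIntegral.integral_of_le Real.two_pi_pos.le, smul_eq_mul]

/-- On circles around a point where `u` is finite, the integrals of the negative part of `u` are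
bounded. -/
lemma IsSubharmonic.lintegral_circle_neg_le (hu : IsSubharmonic u) {z : ℂ} (hz : u z ≠ ⊥) {r M : ℝ}
    (hr : 0 < r) (hM0 : 0 ≤ M) (hM : ∀ w ∈ Metric.sphere z r, u w ≤ (M : EReal)) :
    ∫⁻ θ in Ioc 0 (2 * Real.pi), (-u (circleMap z r θ)).toENNReal ≤
      ENNReal.ofReal (2 * Real.pi * (M - (u z).toReal)) := by
  obtain ⟨h1, h2, h3⟩ := hu.circle hz hr
  have e1 : ∫⁻ θ in Ioc 0 (2 * Real.pi), (-u (circleMap z r θ)).toENNReal =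
      ENNReal.ofReal (∫ θ in Ioc 0 (2 * Real.pi), max (-(u (circleMap z r θ)).toReal) 0) := by
    have h4 := ofReal_integral_eq_lintegral_ofReal (Integrable.pos_part h1.neg)
      (ae_of_all _ fun _ => le_max_right _ _)
    simp only [Pi.neg_apply] at h4
    rw [h4]
    refine lintegral_congr_ae (h2.mono fun θ hθ => ?_)
    simp only
    rw [hθ, ← EReal.coe_neg, EReal.real_coe_toENNReal, EReal.toReal_coe]
    simp [ENNReal.ofReal_max]
  rw [e1]
  refine ENNReal.ofReal_le_ofReal ?_
  have e2 : ∫ θ in Ioc 0 (2 * Real.pi), max (-(u (circleMap z r θ)).toReal) 0 ≤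
      ∫ θ in Ioc 0 (2 * Real.pi), (M - (u (circleMap z r θ)).toReal) := by
    refine integral_mono_ae (Integrable.pos_part h1.neg) ((integrable_const _).sub h1)
      (h2.mono fun θ hθ => ?_)
    have := hM _ (circleMap_mem_sphere z hr.le θ)
    rw [hθ, EReal.coe_le_coe_iff] at this
    exact max_le (by linarith) (by linarith)
  refine e2.trans ?_
  rw [integral_sub (integrable_const _) h1, integral_const]
  rw [Real.circleAverage_def, intervalIntegral.integral_of_le Real.two_pi_pos.le, smul_eq_mul] at h3
  have h4 := mul_le_mul_of_nonneg_left h3 Real.two_pi_pos.le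
  rw [mul_inv_cancel_left₀ (by positivity)] at h4
  simp only [measureReal_restrict_apply_univ, Real.volume_real_Ioc, sub_zero, smul_eq_mul,
    max_eq_left Real.two_pi_pos.le]
  linarith

lemma IsSubharmonic.lintegral_closedBall_neg_ne_top (hu : IsSubharmonic u) {z₀ : ℂ}
    (hz₀ : u z₀ ≠ ⊥) (R : ℝ) :
    ∫⁻ z in Metric.closedBall z₀ R, (-u z).toENNReal ≠ ⊤ := by
  obtain ⟨M, hM0, hM⟩ := hu.exists_le_of_isCompact (isCompact_closedBall z₀ R)
  set W : ℂ → ℝ≥0∞ := fun z => (-u z).toENNReal with hW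
  have hWm : Measurable W := hu.measurable.neg.ereal_toENNReal
  set B : Set ℂ := Metric.closedBall 0 R
  set C := ENNReal.ofReal (2 * Real.pi * (M - (u z₀).toReal))
  have e1 : ∫⁻ z in Metric.closedBall z₀ R, W z = ∫⁻ z, B.indicator (fun z => W (z₀ - z)) z := by
    rw [← lintegral_indicator measurableSet_closedBall,
      ← lintegral_sub_left_eq_self _ z₀]
    refine lintegral_congr fun z => ?_
    by_cases hz : z ∈ B
    · rw [indicator_of_mem hz, indicator_of_mem]
      simpa [B] using hz
    · rw [indicator_of_notMem hz, indicator_of_notMem]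
      simpa [B] using hz
  rw [e1, ← Complex.lintegral_comp_polarCoord_symm, polarCoord_target, Measure.volume_eq_prod,
    ← Measure.prod_restrict]
  have hpt : ∀ r θ : ℝ, z₀ - Complex.polarCoord.symm (r, θ) = circleMap z₀ r (θ + Real.pi) := by
    intro r θ
    rw [Complex.polarCoord_symm_apply, circleMap, Complex.ofReal_add, add_mul, Complex.exp_add,
      Complex.exp_pi_mul_I, Complex.exp_mul_I]
    push_cast
    ring
  have hcircle : ∀ r ∈ Ioc 0 R, ∫⁻ θ in Ioo (-Real.pi) Real.pi, W (circleMap z₀ r (θ + Real.pi)) ≤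
      C := by
    intro r hr
    have h1 := (measurePreserving_add_right volume Real.pi).setLIntegral_comp_preimage
      (s := Ioo 0 (2 * Real.pi)) measurableSet_Ioo
      (hWm.comp (continuous_circleMap z₀ r).measurable)
    have h2 : (fun x => x + Real.pi) ⁻¹' Ioo 0 (2 * Real.pi) = Ioo (-Real.pi) Real.pi := by
      ext x
      simp only [mem_preimage, mem_Ioo]
      constructor <;> rintro ⟨h, h'⟩ <;> constructor <;> linarith
    rw [h2] at h1
    refine (h1.le.trans (lintegral_mono_set Ioo_subset_Ioc_self)).trans ?_
    exact hu.lintegral_circle_neg_le hz₀ hr.1 hM0 fun w hw =>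
      hM w (Metric.sphere_subset_closedBall.trans (Metric.closedBall_subset_closedBall hr.2) hw)
  refine ne_top_of_le_ne_top (b := ∫⁻ r in Ioc 0 R, ENNReal.ofReal R * C) ?_ ?_
  · rw [lintegral_const]
    exact ENNReal.mul_ne_top (ENNReal.mul_ne_top ENNReal.ofReal_ne_top ENNReal.ofReal_ne_top)
      (measure_ne_top _ _)
  refine (lintegral_prod_le _).trans ?_
  rw [← lintegral_indicator measurableSet_Ioi, ← lintegral_indicator measurableSet_Ioc]
  refine lintegral_mono fun r => ?_
  simp only
  by_cases hr0 : r ∈ Ioi (0 : ℝ)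
  swap
  · rw [indicator_of_notMem hr0]
    exact zero_le
  rw [indicator_of_mem hr0]
  have hr0' : 0 < r := hr0
  have hmemB : ∀ θ, Complex.polarCoord.symm (r, θ) ∈ B ↔ r ≤ R := by
    intro θ
    rw [mem_closedBall_zero_iff, Complex.norm_polarCoord_symm, abs_of_pos hr0']
  by_cases hrR : r ≤ R
  · rw [indicator_of_mem (show r ∈ Ioc 0 R from ⟨hr0', hrR⟩)]
    have : ∀ θ, ENNReal.ofReal r • B.indicator (fun z => W (z₀ - z))
        (Complex.polarCoord.symm (r, θ)) =
        ENNReal.ofReal r * W (circleMap z₀ r (θ + Real.pi)) := by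
      intro θ
      rw [indicator_of_mem ((hmemB θ).2 hrR), hpt, smul_eq_mul]
    simp only [this]
    rw [lintegral_const_mul]
    · gcongr
      exact hcircle r ⟨hr0', hrR⟩
    · exact hWm.comp ((continuous_circleMap z₀ r).measurable.comp (measurable_add_const _))
  · have : ∀ θ, ENNReal.ofReal r • B.indicator (fun z => W (z₀ - z))
        (Complex.polarCoord.symm (r, θ)) = 0 := by
      intro θ
      rw [indicator_of_notMem (fun h => hrR ((hmemB θ).1 h)), smul_zero]
    simp only [this, lintegral_zero]
    exact zero_le

lemma IsSubharmonic.integrableOn_closedBall (hu : IsSubharmonic u) {z₀ : ℂ} (hz₀ : u z₀ ≠ ⊥)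
    (R : ℝ) : IntegrableOn (fun z => (u z).toReal) (Metric.closedBall z₀ R) ∧
      ∀ᵐ z ∂volume.restrict (Metric.closedBall z₀ R), u z = ((u z).toReal : EReal) := by
  obtain ⟨M, -, hM⟩ := hu.exists_le_of_isCompact (isCompact_closedBall z₀ R)
  have : IsFiniteMeasure (volume.restrict (Metric.closedBall z₀ R)) :=
    ⟨by simpa using (isCompact_closedBall z₀ R).measure_lt_top (μ := volume)⟩
  exact integrable_toReal_of_lintegral_ne_top hu.measurable.aemeasurable
    (lintegral_toENNReal_ne_top_of_le (M := M)
      ((ae_restrict_mem measurableSet_closedBall).mono fun z hz => hM z hz))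
    (hu.lintegral_closedBall_neg_ne_top hz₀ R)

/-- Subharmonicity is global here, so discs of arbitrary radius around a single point where `u` is
finite suffice. -/
lemma IsProperSubharmonic.locallyIntegrable (hu : IsProperSubharmonic u) :
    LocallyIntegrable (fun z => (u z).toReal) := by
  obtain ⟨hu, z₀, hz₀⟩ := hu
  refine fun z => ⟨Metric.closedBall z₀ (dist z z₀ + 1), ?_,
    (hu.integrableOn_closedBall hz₀ _).1⟩
  exact mem_of_superset (Metric.ball_mem_nhds z one_pos) fun w hw => by
    rw [Metric.mem_closedBall]
    linarith [dist_triangle w z z₀, Metric.mem_ball.1 hw]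

lemma IsProperSubharmonic.ae_eq_toReal (hu : IsProperSubharmonic u) :
    ∀ᵐ z : ℂ, u z = ((u z).toReal : EReal) := by
  obtain ⟨hu, z₀, hz₀⟩ := hu
  have h : ∀ n : ℕ, ∀ᵐ z : ℂ, z ∈ Metric.closedBall z₀ n → u z = ((u z).toReal : EReal) :=
    fun n => (ae_restrict_iff' measurableSet_closedBall).1 (hu.integrableOn_closedBall hz₀ n).2
  filter_upwards [ae_all_iff.2 h] with z hz
  obtain ⟨n, hn⟩ := exists_nat_ge (dist z z₀)
  exact hz n hn

lemma IsProperSubharmonic.ae_ne (hu : IsProperSubharmonic u) : ∀ᵐ z : ℂ, u z ≠ ⊥ ∧ u z ≠ ⊤ :=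
  hu.ae_eq_toReal.mono fun z hz => by
    rw [hz]
    exact ⟨EReal.coe_ne_bot _, EReal.coe_ne_top _⟩

/-- The distributional Laplacian of a subharmonic function is positive. -/
lemma IsProperSubharmonic.integral_mul_laplacian_nonneg (hu : IsProperSubharmonic u) {φ : ℂ → ℝ}
    (hφ : ContDiff ℝ 3 φ) (hs : HasCompactSupport φ) (hφ0 : ∀ z, 0 ≤ φ z) :
    0 ≤ ∫ z, (u z).toReal * (Δ φ) z := by
  refine MonBalayage.integral_mul_laplacian_nonneg hu.locallyIntegrable hφ hs ?_
  filter_upwards [self_mem_nhdsWithin] with r hr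
  refine integral_mono_ae
    (hu.locallyIntegrable.integrable_smul_left_of_hasCompactSupport hφ.continuous hs)
    (integral_mul_circleAverage hu.locallyIntegrable hφ.continuous hs r).1
    (hu.ae_ne.mono fun z hz => ?_)
  exact mul_le_mul_of_nonneg_left (hu.1.circle hz.1 hr).2.2 (hφ0 z)

/-- The distributional Laplacian vanishes where the function is harmonic. -/
lemma integral_mul_laplacian_eq_zero {u f φ : ℂ → ℝ} {O : Set ℂ} (hu : LocallyIntegrable u)
    (hO : IsOpen O) (hf : InnerProductSpace.HarmonicOnNhd f O) (huf : EqOn u f O)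
    (hφ : ContDiff ℝ 3 φ) (hs : HasCompactSupport φ) (hsO : tsupport φ ⊆ O) :
    ∫ z, u z * (Δ φ) z = 0 := by
  obtain ⟨ρ, hρ, hsub⟩ := IsCompact.exists_cthickening_subset_open hs hO hsO
  have key : ∀ ψ : ℂ → ℝ, tsupport ψ ⊆ tsupport φ → ∀ᶠ r in 𝓝[>] (0 : ℝ),
      ∫ z, ψ z * u z ≤ ∫ z, ψ z * Real.circleAverage u z r := by
    intro ψ hψ
    filter_upwards [Ioc_mem_nhdsGT hρ] with r hr
    refine le_of_eq (integral_congr_ae (ae_of_all _ fun z => ?_))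
    simp only
    by_cases hz : z ∈ tsupport ψ
    · congr 1
      have hball : Metric.closedBall z |r| ⊆ O := by
        rw [abs_of_pos hr.1]
        exact ((Metric.closedBall_subset_closedBall hr.2).trans
          (Metric.closedBall_subset_cthickening (hψ hz) ρ)).trans hsub
      rw [Real.circleAverage_congr_sphere (fun w hw =>
        huf (hball (Metric.sphere_subset_closedBall hw))),
        (hf.mono hball).circleAverage_eq, huf (hsO (hψ hz))]
    · rw [image_eq_zero_of_notMem_tsupport hz, zero_mul, zero_mul]
  refine le_antisymm ?_ (integral_mul_laplacian_nonneg hu hφ hs (key φ subset_rfl))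
  have hts : tsupport (-φ) = tsupport φ := tsupport_neg φ
  have := integral_mul_laplacian_nonneg hu hφ.neg hs.neg (key (-φ) hts.le)
  have e : Δ (-φ) = -Δ φ := by
    funext z
    exact congrFun InnerProductSpace.laplacian_neg z
  simp only [← Pi.neg_def] at this
  rw [e] at this
  simp only [Pi.neg_apply, mul_neg, integral_neg] at this
  linarith

end Subharmonic

end MonBalayage

namespace MonBalayage

/-! ### Riesz measures -/

section Riesz

open scoped CompactlySupported

lemma three_le_smooth : (3 : WithTop ℕ∞) ≤ ((⊤ : ℕ∞) : WithTop ℕ∞) :=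
  WithTop.coe_le_coe.2 (le_top : (3 : ℕ∞) ≤ ⊤)

lemma two_le_smooth : (2 : WithTop ℕ∞) ≤ ((⊤ : ℕ∞) : WithTop ℕ∞) :=
  WithTop.coe_le_coe.2 (le_top : (2 : ℕ∞) ≤ ⊤)

/-- The space of smooth functions inside the compactly supported continuous functions. -/
def smoothSubmodule : Submodule ℝ C_c(ℂ, ℝ) where
  carrier := {g | ContDiff ℝ ((⊤ : ℕ∞) : WithTop ℕ∞) fun z => g z}
  add_mem' {f g} hf hg := by
    change ContDiff ℝ ((⊤ : ℕ∞) : WithTop ℕ∞) fun z => f z + g z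
    exact ContDiff.add hf hg
  zero_mem' := by
    change ContDiff ℝ ((⊤ : ℕ∞) : WithTop ℕ∞) fun _ : ℂ => (0 : ℝ)
    exact contDiff_const
  smul_mem' c f hf := by
    change ContDiff ℝ ((⊤ : ℕ∞) : WithTop ℕ∞) fun z => c * f z
    exact contDiff_const.mul hf

/-- The cone of nonnegative functions. -/
def nonnegCone : PointedCone ℝ C_c(ℂ, ℝ) where
  carrier := {g | ∀ z, 0 ≤ g z}
  add_mem' {_ _} hf hg z := add_nonneg (hf z) (hg z)
  zero_mem' _ := le_rfl
  smul_mem' c _ hf z := mul_nonneg c.2 (hf z)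

/-- The pairing of `(2 * π)⁻¹ * Δ u` with smooth compactly supported functions. -/
noncomputable def rieszFunctional (u : ℂ → ℝ) (hu : LocallyIntegrable u) :
    smoothSubmodule →ₗ[ℝ] ℝ where
  toFun g := (2 * Real.pi)⁻¹ * ∫ z, u z * (Δ fun w => (g : C_c(ℂ, ℝ)) w) z
  map_add' f g := by
    have hf : ContDiff ℝ ((⊤ : ℕ∞) : WithTop ℕ∞) fun w => (f : C_c(ℂ, ℝ)) w := f.2
    have hg : ContDiff ℝ ((⊤ : ℕ∞) : WithTop ℕ∞) fun w => (g : C_c(ℂ, ℝ)) w := g.2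
    rw [← mul_add, ← integral_add
      (integrable_mul_laplacian hu (hf.of_le two_le_smooth) f.1.hasCompactSupport)
      (integrable_mul_laplacian hu (hg.of_le two_le_smooth) g.1.hasCompactSupport)]
    congr 2
    funext z
    rw [← mul_add,
      ← (hf.of_le two_le_smooth).contDiffAt.laplacian_add (hg.of_le two_le_smooth).contDiffAt]
    rfl
  map_smul' c g := by
    have hg : ContDiff ℝ ((⊤ : ℕ∞) : WithTop ℕ∞) fun w => (g : C_c(ℂ, ℝ)) w := g.2
    have e : ∀ z, u z * (Δ fun w => ((c • g : smoothSubmodule) : C_c(ℂ, ℝ)) w) z =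
        c * (u z * (Δ fun w => (g : C_c(ℂ, ℝ)) w) z) := by
      intro z
      have := InnerProductSpace.laplacian_smul c (hg.of_le two_le_smooth).contDiffAt (x := z)
      rw [smul_eq_mul] at this
      rw [mul_left_comm, ← this]
      rfl
    simp only [e, integral_const_mul, RingHom.id_apply, smul_eq_mul]
    ring

lemma exists_contDiff_eq_one_closedBall (A : ℝ) : ∃ φ : ℂ → ℝ,
    ContDiff ℝ ((⊤ : ℕ∞) : WithTop ℕ∞) φ ∧
    HasCompactSupport φ ∧ (∀ z, 0 ≤ φ z) ∧ (∀ z, ‖z‖ ≤ A → φ z = 1) := by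
  let b : ContDiffBump (0 : ℂ) := ⟨max A 1, max A 1 + 1, by positivity, by linarith⟩
  exact ⟨b, b.contDiff, b.hasCompactSupport, fun z => b.nonneg, fun z hz =>
    b.one_of_mem_closedBall (mem_closedBall_zero_iff.2 (hz.trans (le_max_left _ _)))⟩

/-- The positive functional `(2 * π)⁻¹ * Δ u` on smooth functions extends to a positive functional
on continuous functions, by M. Riesz' extension theorem, which is represented by a measure. -/
lemma IsProperSubharmonic.exists_isRieszMeasure {u : ℂ → EReal} (hu : IsProperSubharmonic u) :
    ∃ μ : Measure ℂ, IsRieszMeasure u μ := by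
  obtain ⟨Λ, hΛ, hΛpos⟩ := riesz_extension nonnegCone
    ⟨smoothSubmodule, rieszFunctional _ hu.locallyIntegrable⟩ (by
      intro g hg
      have hg' : ContDiff ℝ ((⊤ : ℕ∞) : WithTop ℕ∞) fun w => (g : C_c(ℂ, ℝ)) w := g.2
      exact mul_nonneg (by positivity) (hu.integral_mul_laplacian_nonneg
        (hg'.of_le three_le_smooth) g.1.hasCompactSupport hg)) (by
      intro y
      obtain ⟨C, hC⟩ := y.continuous.bounded_above_of_compact_support y.hasCompactSupport
      obtain ⟨A, hA⟩ := y.hasCompactSupport.isCompact.isBounded.subset_closedBall 0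
      obtain ⟨φ, h1, h2, h3, h4⟩ := exists_contDiff_eq_one_closedBall A
      have hC0 : 0 ≤ C := (norm_nonneg _).trans (hC 0)
      refine ⟨⟨⟨⟨fun z => C * φ z, by fun_prop⟩, h2.mul_left⟩, ?_⟩, fun z => ?_⟩
      · exact contDiff_const.mul h1
      · change 0 ≤ C * φ z + y z
        by_cases hz : z ∈ tsupport y
        · rw [h4 z (mem_closedBall_zero_iff.1 (hA hz))]
          have := neg_abs_le (y z)
          have : ‖y z‖ ≤ C := hC z
          rw [Real.norm_eq_abs] at this
          linarith
        · rw [image_eq_zero_of_notMem_tsupport hz, add_zero]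
          exact mul_nonneg hC0 (h3 z))
  let Λ' : C_c(ℂ, ℝ) →ₚ[ℝ] ℝ := PositiveLinearMap.mk₀ Λ fun g hg => hΛpos g fun z => hg z
  have hreg := RealRMK.regular_rieszMeasure Λ'
  refine ⟨RealRMK.rieszMeasure Λ', inferInstance, hu.ae_ne, hu.locallyIntegrable, ?_⟩
  intro φ hφ hs
  have h1 := RealRMK.integral_rieszMeasure Λ' ⟨⟨φ, hφ.continuous⟩, hs⟩
  have h2 := hΛ ⟨⟨⟨φ, hφ.continuous⟩, hs⟩, hφ⟩
  exact (h1.trans h2).symm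

/-- A Riesz measure vanishes where the function is harmonic. -/
lemma IsRieszMeasure.measure_eq_zero {u : ℂ → EReal} {f : ℂ → ℝ} {O : Set ℂ} {μ : Measure ℂ}
    (hμ : IsRieszMeasure u μ) (hO : IsOpen O) (hf : InnerProductSpace.HarmonicOnNhd f O)
    (huf : ∀ z ∈ O, u z = (f z : EReal)) : μ O = 0 := by
  have := hμ.locallyFinite
  refine measure_null_of_locally_null O fun x hx => ?_
  obtain ⟨φ, h1, h2, h3, h4, h5⟩ := exists_contDiff_tsupport_subset (n := ⊤) (hO.mem_nhds hx)
  have hz := hμ.integral_laplacian φ h3 h2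
  rw [integral_mul_laplacian_eq_zero hμ.locallyIntegrable hO hf
    (fun z hz => by simp [huf z hz]) (h3.of_le three_le_smooth) h2 h1, mul_zero] at hz
  have h6 : φ =ᵐ[μ] 0 := (integral_eq_zero_iff_of_nonneg (fun z => (h4 ⟨z, rfl⟩).1)
    (h3.continuous.integrable_of_hasCompactSupport h2)).1 hz.symm
  refine ⟨{z | φ z ≠ 0}, mem_nhdsWithin_of_mem_nhds ?_, h6⟩
  exact (isOpen_ne_fun h3.continuous continuous_const).mem_nhds (by simp [h5])

lemma IsRieszMeasure.isCompactMeasure {u : ℂ → EReal} {μ : Measure ℂ} {S : Set ℂ}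
    (hμ : IsRieszMeasure u μ) (hS : Bornology.IsBounded S) (hu : IsHarmonicNear u Sᶜ) :
    IsCompactMeasure μ ∧ μ (closure S)ᶜ = 0 := by
  obtain ⟨O, f, hO, hSO, hf, huf⟩ := hu
  have h0 := hμ.measure_eq_zero hO hf huf
  have hsub : μ.support ⊆ S := by
    have h1 := Measure.subset_compl_support_of_isOpen hO h0
    intro z hz
    by_contra hzS
    exact h1 (hSO hzS) hz
  refine ⟨⟨hμ.locallyFinite, ?_⟩, measure_mono_null ?_ h0⟩
  · exact Metric.isCompact_of_isClosed_isBounded Measure.isClosed_support (hS.subset hsub)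
  · exact (compl_subset_compl.2 subset_closure).trans hSO

lemma IsSubharmonic.isProperSubharmonic {u : ℂ → EReal} {S : Set ℂ} (hu : IsSubharmonic u)
    (hS : Bornology.IsBounded S) (h : IsHarmonicNear u Sᶜ) : IsProperSubharmonic u := by
  obtain ⟨O, f, -, hSO, -, huf⟩ := h
  obtain ⟨z, hz⟩ := (ne_univ_iff_exists_notMem S).1 fun h => by
    rw [h] at hS
    exact NormedSpace.unbounded_univ ℝ ℂ hS
  exact ⟨hu, z, by rw [huf z (hSO hz)]; exact EReal.coe_ne_bot _⟩

end Riesz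

end MonBalayage

namespace MonBalayage

/-! ### Laplacians of rescaled and of radial test functions -/

section TestFunctions

lemma laplacian_comp_mul {ψ : ℂ → ℝ} (hψ : ContDiff ℝ 2 ψ) (s : ℝ) (z : ℂ) :
    (Δ fun z : ℂ => ψ (s * z)) z = s ^ 2 * (Δ ψ) (s * z) := by
  have h : ContDiff ℝ 2 fun z : ℂ => ψ (s * z) := hψ.comp (contDiff_const.mul contDiff_id)
  rw [laplacian_eq_iteratedDeriv_lines h, laplacian_eq_iteratedDeriv_lines hψ]
  have key : ∀ e : ℂ, iteratedDeriv 2 (fun t : ℝ => ψ (s * (z + t • e))) 0 =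
      s ^ 2 * iteratedDeriv 2 (fun t : ℝ => ψ (s * z + t • e)) 0 := by
    intro e
    have e1 : (fun t : ℝ => ψ (s * (z + t • e))) = fun t : ℝ =>
        (fun t : ℝ => ψ (s * z + t • e)) (s * t) := by
      funext t
      simp only [Complex.real_smul, Complex.ofReal_mul]
      ring_nf
    have h2 : ContDiff ℝ 2 fun t : ℝ => ψ (s * z + t • e) := by fun_prop
    rw [e1, iteratedDeriv_comp_const_mul h2]
    simp
  rw [key, key, mul_add]

/-- The function `t / 2`, smoothly cut off to `0` for `1 ≤ t`. -/
noncomputable def cutoffHalf (t : ℝ) : ℝ := t / 2 * Real.smoothTransition (1 - t)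

lemma contDiff_cutoffHalf : ContDiff ℝ ((⊤ : ℕ∞) : WithTop ℕ∞) cutoffHalf :=
  (contDiff_id.div_const 2).mul
    (Real.smoothTransition.contDiff.comp (contDiff_const.sub contDiff_id))

lemma cutoffHalf_of_nonpos {t : ℝ} (ht : t ≤ 0) : cutoffHalf t = t / 2 := by
  rw [cutoffHalf, Real.smoothTransition.one_of_one_le (by linarith), mul_one]

lemma cutoffHalf_of_one_le {t : ℝ} (ht : 1 ≤ t) : cutoffHalf t = 0 := by
  rw [cutoffHalf, Real.smoothTransition.zero_of_nonpos (by linarith), mul_zero]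

lemma deriv_cutoffHalf_of_neg {t : ℝ} (ht : t < 0) :
    deriv cutoffHalf t = 1 / 2 ∧ deriv (deriv cutoffHalf) t = 0 := by
  have h1 : ∀ s < 0, deriv cutoffHalf s = 1 / 2 := by
    intro s hs
    have : cutoffHalf =ᶠ[𝓝 s] fun t => t / 2 :=
      eventually_of_mem (Iio_mem_nhds hs) fun t ht => cutoffHalf_of_nonpos (le_of_lt ht)
    rw [this.deriv_eq]
    simp
  refine ⟨h1 t ht, ?_⟩
  have : deriv cutoffHalf =ᶠ[𝓝 t] fun _ => 1 / 2 := by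
    filter_upwards [Iio_mem_nhds ht] with s hs using h1 s hs
  rw [this.deriv_eq]
  simp

lemma deriv_cutoffHalf_of_one_lt {t : ℝ} (ht : 1 < t) :
    deriv cutoffHalf t = 0 ∧ deriv (deriv cutoffHalf) t = 0 := by
  have h1 : ∀ s, 1 < s → deriv cutoffHalf s = 0 := by
    intro s hs
    have : cutoffHalf =ᶠ[𝓝 s] fun _ => 0 := by
      filter_upwards [Ioi_mem_nhds hs] with x hx using cutoffHalf_of_one_le (le_of_lt hx)
    rw [this.deriv_eq]
    simp
  refine ⟨h1 t ht, ?_⟩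
  have : deriv cutoffHalf =ᶠ[𝓝 t] fun _ => 0 := by
    filter_upwards [Ioi_mem_nhds ht] with s hs using h1 s hs
  rw [this.deriv_eq]
  simp

lemma continuous_deriv_cutoffHalf :
    Continuous (deriv cutoffHalf) ∧ Continuous (deriv (deriv cutoffHalf)) := by
  have h1 : ContDiff ℝ 2 cutoffHalf := contDiff_cutoffHalf.of_le two_le_smooth
  have h2 : ContDiff ℝ 1 (deriv cutoffHalf) := by
    have : ContDiff ℝ (1 + 1) cutoffHalf := by
      rw [one_add_one_eq_two]
      exact h1
    exact ContDiff.deriv' this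
  exact ⟨h2.continuous, h2.continuous_deriv le_rfl⟩

lemma exists_bound_deriv_cutoffHalf : ∃ B : ℝ, 0 ≤ B ∧ ∀ t ∈ Icc (0 : ℝ) 1,
    |deriv cutoffHalf t| ≤ B ∧ |deriv (deriv cutoffHalf) t| ≤ B := by
  obtain ⟨B₁, h1⟩ := isCompact_Icc.exists_bound_of_continuousOn
    (continuous_deriv_cutoffHalf.1.continuousOn (s := Icc 0 1))
  obtain ⟨B₂, h2⟩ := isCompact_Icc.exists_bound_of_continuousOn
    (continuous_deriv_cutoffHalf.2.continuousOn (s := Icc 0 1))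
  refine ⟨max B₁ B₂, ((norm_nonneg _).trans (h1 0 (by simp))).trans (le_max_left _ _),
    fun t ht => ⟨(h1 t ht).trans (le_max_left _ _), (h2 t ht).trans (le_max_right _ _)⟩⟩

lemma iteratedDeriv_two_comp_log {Θ : ℝ → ℝ} (hΘ : ContDiff ℝ 2 Θ) (a c : ℝ) {b : ℝ} (hb : 0 < b) :
    iteratedDeriv 2 (fun t : ℝ => Θ (Real.log ((a + t) ^ 2 + b) - c)) 0 =
      deriv (deriv Θ) (Real.log (a ^ 2 + b) - c) * (2 * a / (a ^ 2 + b)) ^ 2 +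
      deriv Θ (Real.log (a ^ 2 + b) - c) * (2 / (a ^ 2 + b) - (2 * a / (a ^ 2 + b)) ^ 2) := by
  have hq : ∀ t : ℝ, (a + t) ^ 2 + b ≠ 0 := fun t => by positivity
  have hΘ1 : ContDiff ℝ (1 + 1) Θ := by
    rw [one_add_one_eq_two]
    exact hΘ
  have hd1 : Differentiable ℝ Θ := hΘ.differentiable (by norm_num)
  have hd2 : Differentiable ℝ (deriv Θ) := (ContDiff.deriv' hΘ1).differentiable (by norm_num)
  have hquad : ∀ t : ℝ, HasDerivAt (fun t : ℝ => (a + t) ^ 2 + b) (2 * (a + t)) t := by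
    intro t
    have := (((hasDerivAt_id t).const_add a).pow 2).add_const b
    simpa using this
  have hL : ∀ t : ℝ, HasDerivAt (fun t : ℝ => Real.log ((a + t) ^ 2 + b) - c)
      (2 * (a + t) / ((a + t) ^ 2 + b)) t := fun t => ((hquad t).log (hq t)).sub_const c
  have h1 : deriv (fun t : ℝ => Θ (Real.log ((a + t) ^ 2 + b) - c)) = fun t : ℝ =>
      deriv Θ (Real.log ((a + t) ^ 2 + b) - c) * (2 * (a + t) / ((a + t) ^ 2 + b)) :=
    funext fun t => ((hd1 _).hasDerivAt.comp t (hL t)).deriv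
  have hlin : HasDerivAt (fun t : ℝ => 2 * (a + t)) 2 0 := by
    simpa using ((hasDerivAt_id (0 : ℝ)).const_add a).const_mul 2
  have h2 := (((hd2 _).hasDerivAt.comp (0 : ℝ) (hL 0)).mul (hlin.div (hquad 0) (hq 0))).deriv
  rw [iteratedDeriv_succ, iteratedDeriv_one, h1]
  refine Eq.trans h2 ?_
  simp only [Function.comp_apply, Pi.div_apply, add_zero]
  have := hq 0
  rw [add_zero] at this
  field_simp

/-- The Laplacian of a function of `log (‖z - w‖ ^ 2 + ε ^ 2)`. -/
lemma laplacian_comp_log {Θ : ℝ → ℝ} (hΘ : ContDiff ℝ 2 Θ) {ε : ℝ} (hε : 0 < ε) (w z : ℂ) (c : ℝ) :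
    (Δ fun z : ℂ => Θ (Real.log (‖z - w‖ ^ 2 + ε ^ 2) - c)) z =
      4 * (‖z - w‖ ^ 2 * deriv (deriv Θ) (Real.log (‖z - w‖ ^ 2 + ε ^ 2) - c) +
        ε ^ 2 * deriv Θ (Real.log (‖z - w‖ ^ 2 + ε ^ 2) - c)) / (‖z - w‖ ^ 2 + ε ^ 2) ^ 2 := by
  have hf : ContDiff ℝ 2 fun z : ℂ => Θ (Real.log (‖z - w‖ ^ 2 + ε ^ 2) - c) :=
    hΘ.comp ((((((contDiff_norm_sq ℝ).comp (contDiff_id.sub contDiff_const))).add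
      contDiff_const).log fun z => (norm_sq_add_sq_pos hε (z - w)).ne').sub contDiff_const)
  have hn : ∀ z : ℂ, ‖z‖ ^ 2 = z.re ^ 2 + z.im ^ 2 := fun z => by
    rw [← Complex.normSq_eq_norm_sq, Complex.normSq_apply]
    ring
  rw [laplacian_eq_iteratedDeriv_lines hf]
  set x := (z - w).re
  set y := (z - w).im
  have e1 : (fun t : ℝ => Θ (Real.log (‖z + t • (1 : ℂ) - w‖ ^ 2 + ε ^ 2) - c)) =
      fun t : ℝ => Θ (Real.log ((x + t) ^ 2 + (y ^ 2 + ε ^ 2)) - c) := by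
    funext t
    have h1 : (z + t • (1 : ℂ) - w).re = x + t := by simp [x]; ring
    have h2 : (z + t • (1 : ℂ) - w).im = y := by simp [y]
    rw [hn, h1, h2, add_assoc]
  have e2 : (fun t : ℝ => Θ (Real.log (‖z + t • Complex.I - w‖ ^ 2 + ε ^ 2) - c)) =
      fun t : ℝ => Θ (Real.log ((y + t) ^ 2 + (x ^ 2 + ε ^ 2)) - c) := by
    funext t
    have h1 : (z + t • Complex.I - w).re = x := by simp [x]
    have h2 : (z + t • Complex.I - w).im = y + t := by simp [y]; ring
    rw [hn, h1, h2, add_assoc, add_left_comm]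
  rw [e1, e2, iteratedDeriv_two_comp_log hΘ _ _ (by positivity),
    iteratedDeriv_two_comp_log hΘ _ _ (by positivity), show ‖z - w‖ ^ 2 = x ^ 2 + y ^ 2 from hn _]
  have e3 : y ^ 2 + (x ^ 2 + ε ^ 2) = x ^ 2 + y ^ 2 + ε ^ 2 := by ring
  have e4 : x ^ 2 + (y ^ 2 + ε ^ 2) = x ^ 2 + y ^ 2 + ε ^ 2 := by ring
  rw [e3, e4]
  have : x ^ 2 + y ^ 2 + ε ^ 2 ≠ 0 := by positivity
  generalize deriv (deriv Θ) (Real.log (x ^ 2 + y ^ 2 + ε ^ 2) - c) = P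
  generalize deriv Θ (Real.log (x ^ 2 + y ^ 2 + ε ^ 2) - c) = Q
  field_simp
  ring

end TestFunctions

end MonBalayage

namespace MonBalayage

/-! ### From the growth of the difference to balayage -/

section Converse

variable {d v : ℂ → EReal} {δ ω : Measure ℂ} {p : ℝ≥0∞}

lemma IsRieszMeasure.integral_sub_integral (hd : IsRieszMeasure d δ) (hv : IsRieszMeasure v ω)
    {φ : ℂ → ℝ} (hφ : ContDiff ℝ ((⊤ : ℕ∞) : WithTop ℕ∞) φ) (hs : HasCompactSupport φ) :
    ∫ z, φ z ∂ω - ∫ z, φ z ∂δ =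
      (2 * Real.pi)⁻¹ * ∫ z, ((v z).toReal - (d z).toReal) * (Δ φ) z := by
  rw [← hd.integral_laplacian φ hφ hs, ← hv.integral_laplacian φ hφ hs, ← mul_sub,
    ← integral_sub (integrable_mul_laplacian hv.locallyIntegrable (hφ.of_le two_le_smooth) hs)
      (integrable_mul_laplacian hd.locallyIntegrable (hφ.of_le two_le_smooth) hs)]
  simp only [sub_mul]

/-- A test function argument: if `a` is the difference of the integrals of test functions `φ` at
all large scales `R`, and `(v - d) * Δ φ` is bounded below by `-K / R ^ 3` on a disc of radius
`A * R`, whose area is of order `R ^ 2`, then `a` is nonnegative. -/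
lemma nonneg_of_forall_test (hd : IsRieszMeasure d δ) (hv : IsRieszMeasure v ω) {a K A : ℝ}
    (hA : 0 ≤ A) (H : ∀ᶠ R : ℝ in atTop, ∃ φ : ℂ → ℝ,
      ContDiff ℝ ((⊤ : ℕ∞) : WithTop ℕ∞) φ ∧ HasCompactSupport φ ∧
      ∫ z, φ z ∂ω - ∫ z, φ z ∂δ = a ∧
      ∀ᵐ z : ℂ, -(Metric.closedBall (0 : ℂ) (A * R)).indicator (fun _ => K / R ^ 3) z ≤
        ((v z).toReal - (d z).toReal) * (Δ φ) z) : 0 ≤ a := by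
  have key : ∀ᶠ R : ℝ in atTop, -((2 * Real.pi)⁻¹ * (K * (Real.pi * A ^ 2))) / R ≤ a := by
    filter_upwards [H, eventually_gt_atTop 0] with R ⟨φ, hφ, hs, ha, hlow⟩ hR
    have hball : volume.real (Metric.closedBall (0 : ℂ) (A * R)) = Real.pi * (A * R) ^ 2 := by
      rw [Measure.real, Complex.volume_closedBall]
      simp [ENNReal.toReal_ofReal (mul_nonneg hA hR.le), mul_comm]
    have hi : Integrable ((Metric.closedBall (0 : ℂ) (A * R)).indicator fun _ => K / R ^ 3) :=
      (integrableOn_const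
        (isCompact_closedBall (0 : ℂ) (A * R)).measure_lt_top.ne).integrable_indicator
        measurableSet_closedBall
    have h1 := integral_mono_ae hi.neg (integrable_mul_laplacian
      (hv.locallyIntegrable.sub hd.locallyIntegrable) (hφ.of_le two_le_smooth) hs) hlow
    simp only [Pi.neg_apply, integral_neg] at h1
    rw [integral_indicator measurableSet_closedBall, setIntegral_const, hball, smul_eq_mul] at h1
    rw [← ha, hd.integral_sub_integral hv hφ hs]
    refine le_trans (le_of_eq ?_) (mul_le_mul_of_nonneg_left h1 (by positivity))
    field_simp
  refine le_of_tendsto ?_ key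
  exact tendsto_const_nhds.div_atTop tendsto_id

lemma EqUpToDecay.exists_bound (h : EqUpToDecay p v d) {k : ℕ} (hk : (k : ℝ≥0∞) ≤ p) :
    ∃ C R₀ : ℝ, 0 ≤ C ∧ 1 ≤ R₀ ∧ ∀ z, R₀ ≤ ‖z‖ →
      |(v z).toReal - (d z).toReal| ≤ C / ‖z‖ ^ (k + 1) := by
  obtain ⟨C, hC, hb⟩ := h.2.exists_nonneg
  rw [Asymptotics.isBigOWith_iff, ← comap_norm_atTop, eventually_comap] at hb
  obtain ⟨R, hR⟩ := eventually_atTop.1 hb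
  refine ⟨C, max R 1, hC, le_max_right _ _, fun z hz => ?_⟩
  have h1 := hR ‖z‖ ((le_max_left _ _).trans hz) z rfl
  have hz1 : 1 ≤ ‖z‖ := (le_max_right _ _).trans hz
  rw [Real.norm_eq_abs] at h1
  refine h1.trans ?_
  rw [div_eq_mul_one_div]
  refine mul_le_mul_of_nonneg_left ?_ hC
  unfold decayRate
  split_ifs with hp
  · rw [norm_zero]
    positivity
  · rw [Real.norm_of_nonneg (by positivity)]
    have := le_natFloor_toReal hp hk
    gcongr

lemma re_mul_pow_scale (c z : ℂ) (s : ℝ) (k : ℕ) :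
    (c * (s * z) ^ k).re = s ^ k * (c * z ^ k).re := by
  have : c * ((s : ℂ) * z) ^ k = ((s ^ k : ℝ) : ℂ) * (c * z ^ k) := by
    push_cast
    ring
  rw [this, Complex.re_ofReal_mul]

lemma harmonicAt_re_mul_pow (c z : ℂ) (k : ℕ) :
    InnerProductSpace.HarmonicAt (fun z : ℂ => (c * z ^ k).re) z :=
  AnalyticAt.harmonicAt_re (f := fun z => c * z ^ k)
    (analyticAt_const.mul (analyticAt_id.pow k))

/-- Moments are compared by testing against `χ (z / R) * re (c * z ^ k)` for a cutoff `χ`. -/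
lemma integral_re_mul_pow_le (hd : IsRieszMeasure d δ) (hv : IsRieszMeasure v ω)
    (hδ : IsCompactMeasure δ) (hω : IsCompactMeasure ω) (h : EqUpToDecay p v d) {k : ℕ}
    (hk : (k : ℝ≥0∞) ≤ p) (c : ℂ) :
    ∫ z, (c * z ^ k).re ∂δ ≤ ∫ z, (c * z ^ k).re ∂ω := by
  obtain ⟨C, R₀, hC, hR₀, hdec⟩ := h.exists_bound hk
  obtain ⟨χ, hχ, hχs, -, hχ1⟩ := exists_contDiff_eq_one_closedBall 1
  obtain ⟨A, hA0, hA⟩ := hχs.isCompact.isBounded.subset_closedBall_lt 0 0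
  obtain ⟨R₁, hR₁, hsub⟩ :=
    (hδ.isCompact_support.union hω.isCompact_support).isBounded.subset_closedBall_lt 0 0
  obtain ⟨hδR, hωR⟩ := union_subset_iff.1 hsub
  have hh : ContDiff ℝ ((⊤ : ℕ∞) : WithTop ℕ∞) fun z : ℂ => (c * z ^ k).re :=
    Complex.reCLM.contDiff.comp (contDiff_const.mul (contDiff_id.pow k))
  set ψ : ℂ → ℝ := fun z => χ z * (c * z ^ k).re with hψdef
  have hψ : ContDiff ℝ ((⊤ : ℕ∞) : WithTop ℕ∞) ψ := hχ.mul hh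
  have hψs : HasCompactSupport ψ := hχs.mul_right
  obtain ⟨B, hB⟩ := (continuous_laplacian (hψ.of_le two_le_smooth)).bounded_above_of_compact_support
    (hasCompactSupport_laplacian hψs)
  have hψin : ∀ ζ : ℂ, ‖ζ‖ < 1 → (Δ ψ) ζ = 0 := by
    intro ζ hζ
    have h1 : ψ =ᶠ[𝓝 ζ] fun z => (c * z ^ k).re := by
      filter_upwards [Metric.isOpen_ball.mem_nhds (mem_ball_zero_iff.2 hζ)] with z hz
      rw [hψdef]
      simp only
      rw [hχ1 z (mem_ball_zero_iff.1 hz).le, one_mul]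
    rw [(InnerProductSpace.laplacian_congr_nhds h1).eq_of_nhds]
    exact (harmonicAt_re_mul_pow c ζ k).2.eq_of_nhds
  have hψout : ∀ ζ : ℂ, A < ‖ζ‖ → (Δ ψ) ζ = 0 := by
    intro ζ hζ
    refine laplacian_eq_zero_of_notMem_tsupport fun hmem => ?_
    have := mem_closedBall_zero_iff.1 (hA (tsupport_mul_subset_left hmem))
    linarith
  rw [← sub_nonneg]
  refine nonneg_of_forall_test hd hv (K := C * B) hA0.le ?_
  filter_upwards [eventually_ge_atTop R₀, eventually_ge_atTop R₁] with R hRR₀ hRR₁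
  have hR : 0 < R := by linarith
  have hscale : ContDiff ℝ ((⊤ : ℕ∞) : WithTop ℕ∞) fun z : ℂ => ψ ((R⁻¹ : ℝ) * z) :=
    hψ.comp (contDiff_const.mul contDiff_id)
  have hnorm : ∀ z : ℂ, ‖((R⁻¹ : ℝ) : ℂ) * z‖ = ‖z‖ / R := by
    intro z
    rw [norm_mul, Complex.norm_real, Real.norm_of_nonneg (by positivity)]
    field_simp
  have hlap : ∀ z, (Δ fun z : ℂ => R ^ k * ψ ((R⁻¹ : ℝ) * z)) z =
      R ^ k * (R⁻¹ ^ 2 * (Δ ψ) ((R⁻¹ : ℝ) * z)) := by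
    intro z
    have h1 := InnerProductSpace.laplacian_smul (R ^ k)
      (hscale.of_le two_le_smooth).contDiffAt (x := z)
    rw [laplacian_comp_mul (hψ.of_le two_le_smooth)] at h1
    exact h1
  refine ⟨fun z => R ^ k * ψ ((R⁻¹ : ℝ) * z), contDiff_const.mul hscale, ?_, ?_, ?_⟩
  · refine HasCompactSupport.intro (isCompact_closedBall (0 : ℂ) (A * R)) fun z hz => ?_
    rw [mem_closedBall_zero_iff, not_le] at hz
    have : ((R⁻¹ : ℝ) : ℂ) * z ∉ tsupport ψ := fun hmem => by
      have := mem_closedBall_zero_iff.1 (hA (tsupport_mul_subset_left hmem))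
      rw [hnorm, div_le_iff₀ hR] at this
      linarith
    rw [image_eq_zero_of_notMem_tsupport this, mul_zero]
  · have hin : ∀ z : ℂ, ‖z‖ ≤ R₁ → R ^ k * ψ ((R⁻¹ : ℝ) * z) = (c * z ^ k).re := by
      intro z hz
      simp only [hψdef]
      rw [hχ1 _ (by rw [hnorm, div_le_one hR]; linarith), one_mul, re_mul_pow_scale, ← mul_assoc,
        ← mul_pow, mul_inv_cancel₀ hR.ne', one_pow, one_mul]
    congr 1
    · exact integral_congr_ae (hω.ae_mem_support.mono fun z hz =>
        hin z (mem_closedBall_zero_iff.1 (hωR hz)))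
    · exact integral_congr_ae (hδ.ae_mem_support.mono fun z hz =>
        hin z (mem_closedBall_zero_iff.1 (hδR hz)))
  · refine ae_of_all _ fun z => ?_
    have hB0 : 0 ≤ B := (norm_nonneg _).trans (hB 0)
    have hind : 0 ≤ (Metric.closedBall (0 : ℂ) (A * R)).indicator (fun _ => C * B / R ^ 3) z :=
      indicator_nonneg (fun _ _ => by positivity) z
    rw [hlap]
    rcases lt_or_ge ‖z‖ R with h1 | h1
    · rw [hψin _ (by rw [hnorm, div_lt_one hR]; exact h1)]
      simpa using hind
    rcases lt_or_ge (A * R) ‖z‖ with h2 | h2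
    · rw [hψout _ (by rw [hnorm, lt_div_iff₀ hR]; exact h2)]
      simpa using hind
    rw [indicator_of_mem (mem_closedBall_zero_iff.2 h2)]
    refine (abs_le.1 ?_).1
    rw [abs_mul, abs_mul, abs_mul, abs_of_pos (by positivity : 0 < R ^ k),
      abs_of_pos (by positivity : 0 < R⁻¹ ^ 2)]
    have h3 : |(v z).toReal - (d z).toReal| ≤ C / R ^ (k + 1) :=
      (hdec z (hRR₀.trans h1)).trans (by gcongr)
    calc |(v z).toReal - (d z).toReal| * (R ^ k * (R⁻¹ ^ 2 * |(Δ ψ) (((R⁻¹ : ℝ) : ℂ) * z)|))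
        ≤ C / R ^ (k + 1) * (R ^ k * (R⁻¹ ^ 2 * B)) := by
          gcongr
          exact hB _
      _ = C * B / R ^ 3 := by
          field_simp
          ring

lemma IsCompactMeasure.integralWellDefined_mon (hδ : IsCompactMeasure δ) {h : ℂ → EReal}
    (hh : h ∈ mon p) : IntegralWellDefined δ h := by
  obtain ⟨k, c, -, rfl⟩ := hh
  exact Or.inl (lintegral_toENNReal_coe_ne_top
    (hδ.integrable (by fun_prop : Continuous fun z : ℂ => (c * z ^ k).re).continuousOn))

lemma isBalayage_mon (hd : IsRieszMeasure d δ) (hv : IsRieszMeasure v ω)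
    (hδ : IsCompactMeasure δ) (hω : IsCompactMeasure ω) (h : EqUpToDecay p v d) :
    IsBalayage (mon p) ω δ := by
  intro f hf
  refine ⟨hδ.integralWellDefined_mon hf, hω.integralWellDefined_mon hf, ?_⟩
  obtain ⟨k, c, hk, rfl⟩ := hf
  have hc : Continuous fun z : ℂ => (c * z ^ k).re := by fun_prop
  rw [eintegral_coe (hδ.integrable hc.continuousOn), eintegral_coe (hω.integrable hc.continuousOn)]
  exact_mod_cast integral_re_mul_pow_le hd hv hδ hω h hk c

/-- Regularized potentials are compared by testing against a cutoff of the regularized logarithm,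
made as a function of `log (‖z - w‖ ^ 2 + ε ^ 2)`; its Laplacian is nonnegative before the cutoff
sets in. -/
lemma integral_regLog_le (hd : IsRieszMeasure d δ) (hv : IsRieszMeasure v ω)
    (hδ : IsCompactMeasure δ) (hω : IsCompactMeasure ω) (h : EqUpToDecay p v d)
    (hdv : ∀ z, d z ≤ v z) {ε : ℝ} (hε : 0 < ε) (w : ℂ) :
    ∫ z, regLog ε (z - w) ∂δ ≤ ∫ z, regLog ε (z - w) ∂ω := by
  have := hδ.isFiniteMeasure
  have := hω.isFiniteMeasure
  have hmass := measureReal_univ_eq hδ hω (isBalayage_mon hd hv hδ hω h)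
  obtain ⟨C, R₀, hC, hR₀, hdec⟩ := h.exists_bound (k := 0) (by simp)
  obtain ⟨B, hB0, hB⟩ := exists_bound_deriv_cutoffHalf
  obtain ⟨R₁, hR₁, hsub⟩ :=
    (hδ.isCompact_support.union hω.isCompact_support).isBounded.subset_closedBall_lt 0 0
  obtain ⟨hδR, hωR⟩ := union_subset_iff.1 hsub
  rw [← sub_nonneg]
  refine nonneg_of_forall_test hd hv (K := 4 * C * (4 * B * (1 + ε ^ 2))) (A := 3) (by norm_num) ?_
  filter_upwards [eventually_ge_atTop (4 * R₀), eventually_ge_atTop (R₁ + ‖w‖ + ε),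
    eventually_ge_atTop (4 * ‖w‖), eventually_ge_atTop (2 * ε)] with R h1 h2 h3 h4
  have hw0 := norm_nonneg w
  have hR : 1 ≤ R := by linarith
  have hR0 : 0 < R := by linarith
  have hpos : ∀ z : ℂ, 0 < ‖z - w‖ ^ 2 + ε ^ 2 := fun z => norm_sq_add_sq_pos hε _
  set T : ℂ → ℝ := fun z => Real.log (‖z - w‖ ^ 2 + ε ^ 2) - 2 * Real.log R with hT
  have hlogR : 2 * Real.log R = Real.log (R ^ 2) := by rw [Real.log_pow]; push_cast; ring
  have hTlt : ∀ z, ‖z - w‖ ^ 2 + ε ^ 2 < R ^ 2 ↔ T z < 0 := fun z => by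
    rw [hT]
    simp only
    rw [hlogR, sub_neg, Real.log_lt_log_iff (hpos z) (by positivity)]
  have hTbig : ∀ z, 3 * R < ‖z‖ → 1 < T z := by
    intro z hz
    have h5 : 2 * R ≤ ‖z - w‖ := by
      have := norm_sub_norm_le z w
      linarith
    have h6 : (2 * R) ^ 2 ≤ ‖z - w‖ ^ 2 + ε ^ 2 := by nlinarith
    have h7 := Real.log_le_log (by positivity) h6
    rw [Real.log_pow, Real.log_mul (by norm_num) hR0.ne'] at h7
    push_cast at h7
    have := Real.log_two_gt_d9
    rw [hT]
    simp only
    linarith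
  refine ⟨fun z => cutoffHalf (T z), ?_, ?_, ?_, ?_⟩
  · exact contDiff_cutoffHalf.comp ((((((contDiff_norm_sq ℝ).comp
      (contDiff_id.sub contDiff_const))).add contDiff_const).log fun z => (hpos z).ne').sub
        contDiff_const)
  · refine HasCompactSupport.intro (isCompact_closedBall (0 : ℂ) (3 * R)) fun z hz => ?_
    rw [mem_closedBall_zero_iff, not_le] at hz
    exact cutoffHalf_of_one_le (hTbig z hz).le
  · -- The constant `log R` cancels because the total masses agree.
    have hin : ∀ z : ℂ, ‖z‖ ≤ R₁ → cutoffHalf (T z) = regLog ε (z - w) - Real.log R := by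
      intro z hz
      have h5 : ‖z - w‖ ≤ R₁ + ‖w‖ := (norm_sub_le _ _).trans (by linarith)
      have h6 : ‖z - w‖ ^ 2 + ε ^ 2 ≤ R ^ 2 := by
        have := norm_nonneg (z - w)
        nlinarith
      have h7 := Real.log_le_log (hpos z) h6
      rw [cutoffHalf_of_nonpos (by rw [hT]; simp only; linarith), regLog, hT]
      simp only
      ring
    have hint : ∀ μ : Measure ℂ, IsCompactMeasure μ → μ.support ⊆ Metric.closedBall 0 R₁ →
        ∫ z, cutoffHalf (T z) ∂μ = ∫ z, regLog ε (z - w) ∂μ - μ.real univ * Real.log R := by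
      intro μ hμ hμR
      have := hμ.isFiniteMeasure
      rw [integral_congr_ae (hμ.ae_mem_support.mono fun z hz =>
        hin z (mem_closedBall_zero_iff.1 (hμR hz))),
        integral_sub (hμ.integrable_regLog hε w) (integrable_const _), integral_const, smul_eq_mul]
    rw [hint ω hω hωR, hint δ hδ hδR, hmass]
    ring
  · filter_upwards [hd.ae_finite, hv.ae_finite] with z hdz hvz
    have hind : 0 ≤ (Metric.closedBall (0 : ℂ) (3 * R)).indicator
        (fun _ => 4 * C * (4 * B * (1 + ε ^ 2)) / R ^ 3) z :=
      indicator_nonneg (fun _ _ => by positivity) z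
    rw [laplacian_comp_log (contDiff_cutoffHalf.of_le two_le_smooth) hε]
    change _ ≤ _ * (4 * (‖z - w‖ ^ 2 * deriv (deriv cutoffHalf) (T z) +
      ε ^ 2 * deriv cutoffHalf (T z)) / (‖z - w‖ ^ 2 + ε ^ 2) ^ 2)
    set q := ‖z - w‖ ^ 2 + ε ^ 2 with hq
    have hq0 : 0 < q := hpos z
    rcases lt_or_ge (T z) 0 with hT0 | hT0
    · obtain ⟨e1, e2⟩ := deriv_cutoffHalf_of_neg hT0
      rw [e1, e2]
      have hD : 0 ≤ (v z).toReal - (d z).toReal :=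
        sub_nonneg.2 (EReal.toReal_le_toReal (hdv z) hdz.1 hvz.2)
      have : 0 ≤ ((v z).toReal - (d z).toReal) *
          (4 * (‖z - w‖ ^ 2 * 0 + ε ^ 2 * (1 / 2)) / q ^ 2) := by positivity
      linarith
    rcases lt_or_ge 1 (T z) with hT1 | hT1
    · obtain ⟨e1, e2⟩ := deriv_cutoffHalf_of_one_lt hT1
      rw [e1, e2]
      simpa using hind
    have hz3 : ‖z‖ ≤ 3 * R := by
      by_contra! hcon
      linarith [hTbig z hcon]
    have hqR : R ^ 2 ≤ q := by
      by_contra! hcon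
      linarith [(hTlt z).1 hcon]
    have hzR : R / 4 ≤ ‖z‖ := by
      have h5 : R / 2 ≤ ‖z - w‖ := by
        by_contra! hcon
        have := norm_nonneg (z - w)
        nlinarith
      have := norm_sub_le z w
      linarith
    rw [indicator_of_mem (mem_closedBall_zero_iff.2 hz3)]
    refine (abs_le.1 ?_).1
    have hDb : |(v z).toReal - (d z).toReal| ≤ 4 * C / R := by
      refine (hdec z (by linarith)).trans ?_
      rw [zero_add, pow_one]
      calc C / ‖z‖ ≤ C / (R / 4) := by gcongr
        _ = 4 * C / R := by field_simp
    obtain ⟨b1, b2⟩ := hB (T z) ⟨hT0, hT1⟩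
    have hLb : |4 * (‖z - w‖ ^ 2 * deriv (deriv cutoffHalf) (T z) +
        ε ^ 2 * deriv cutoffHalf (T z)) / q ^ 2| ≤ 4 * B * (1 + ε ^ 2) / R ^ 2 := by
      rw [abs_div, abs_of_pos (by positivity : 0 < q ^ 2), abs_mul,
        abs_of_pos (by norm_num : (0 : ℝ) < 4)]
      have h6 : |‖z - w‖ ^ 2 * deriv (deriv cutoffHalf) (T z) + ε ^ 2 * deriv cutoffHalf (T z)| ≤
          ‖z - w‖ ^ 2 * B + ε ^ 2 * B := by
        refine (abs_add_le _ _).trans ?_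
        rw [abs_mul, abs_mul, abs_of_nonneg (by positivity : 0 ≤ ‖z - w‖ ^ 2),
          abs_of_pos (by positivity : 0 < ε ^ 2)]
        gcongr
      have h7 : ‖z - w‖ ^ 2 * B + ε ^ 2 * B = q * B := by rw [hq]; ring
      rw [h7] at h6
      calc _ ≤ 4 * (q * B) / q ^ 2 := by gcongr
        _ = 4 * B / q := by field_simp
        _ ≤ 4 * B / R ^ 2 := by gcongr
        _ ≤ 4 * B * (1 + ε ^ 2) / R ^ 2 := by
          refine div_le_div_of_nonneg_right ?_ (by positivity)
          exact le_mul_of_one_le_right (by positivity) (by linarith [sq_nonneg ε])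
    rw [abs_mul]
    calc _ ≤ 4 * C / R * (4 * B * (1 + ε ^ 2) / R ^ 2) := by gcongr
      _ = _ := by field_simp

lemma pt_le_pt (hd : IsRieszMeasure d δ) (hv : IsRieszMeasure v ω)
    (hδ : IsCompactMeasure δ) (hω : IsCompactMeasure ω) (h : EqUpToDecay p v d)
    (hdv : ∀ z, d z ≤ v z) (w : ℂ) : pt δ w ≤ pt ω w := by
  rw [hω.pt_eq_iInf]
  refine le_iInf fun n => (hδ.pt_le (regSeq_pos n) w).trans ?_
  exact_mod_cast integral_regLog_le hd hv hδ hω h hdv (regSeq_pos n) w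

lemma isBalayage_lnmon (hd : IsRieszMeasure d δ) (hv : IsRieszMeasure v ω)
    (hδ : IsCompactMeasure δ) (hω : IsCompactMeasure ω) (h : EqUpToDecay p v d)
    (hdv : ∀ z, d z ≤ v z) : IsBalayage (lnmon p) ω δ := by
  rintro f (⟨w, rfl⟩ | hf)
  · exact ⟨Or.inl (hδ.lintegral_logKernel_ne_top w), Or.inl (hω.lintegral_logKernel_ne_top w),
      pt_le_pt hd hv hδ hω h hdv w⟩
  · exact isBalayage_mon hd hv hδ hω h f hf

end Converse

end MonBalayage

theorem mainTheorem2 (p : ℝ≥0∞) :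
    (∀ δ ω : Measure ℂ, IsCompactMeasure δ → IsCompactMeasure ω →
      (IsBalayage (mon p) ω δ →
        (IsProperSubharmonic (pt δ) ∧ IsHarmonicNear (pt δ) (δ.support)ᶜ) ∧
        (IsProperSubharmonic (pt ω) ∧ IsHarmonicNear (pt ω) (ω.support)ᶜ) ∧
        EqUpToDecay p (pt ω) (pt δ)) ∧
      (IsBalayage (lnmon p) ω δ →
        (IsProperSubharmonic (pt δ) ∧ IsHarmonicNear (pt δ) (δ.support)ᶜ) ∧
        (IsProperSubharmonic (pt ω) ∧ IsHarmonicNear (pt ω) (ω.support)ᶜ) ∧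
        EqUpToDecay p (pt ω) (pt δ) ∧
        ∀ w : ℂ, pt δ w ≤ pt ω w)) ∧
    (∀ (S : Set ℂ) (d v : ℂ → EReal), Bornology.IsBounded S →
      IsSubharmonic d → IsHarmonicNear d Sᶜ →
      IsSubharmonic v → IsHarmonicNear v Sᶜ →
      EqUpToDecay p v d →
      (∃ δ : Measure ℂ, IsRieszMeasure d δ) ∧ (∃ ω : Measure ℂ, IsRieszMeasure v ω) ∧
      ∀ δ ω : Measure ℂ, IsRieszMeasure d δ → IsRieszMeasure v ω →
        (IsCompactMeasure δ ∧ δ (closure S)ᶜ = 0) ∧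
        (IsCompactMeasure ω ∧ ω (closure S)ᶜ = 0) ∧
        IsBalayage (mon p) ω δ ∧
        ((∀ w : ℂ, d w ≤ v w) → IsBalayage (lnmon p) ω δ)) := by
  refine ⟨fun δ ω hδ hω => ?_, ?_⟩
  · have key : IsBalayage (mon p) ω δ →
        (IsProperSubharmonic (pt δ) ∧ IsHarmonicNear (pt δ) (δ.support)ᶜ) ∧
        (IsProperSubharmonic (pt ω) ∧ IsHarmonicNear (pt ω) (ω.support)ᶜ) ∧
        EqUpToDecay p (pt ω) (pt δ) := fun h =>
      ⟨⟨hδ.isProperSubharmonic_pt, hδ.isHarmonicNear_pt⟩,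
        ⟨hω.isProperSubharmonic_pt, hω.isHarmonicNear_pt⟩, eqUpToDecay_pt hδ hω h⟩
    refine ⟨key, fun h => ?_⟩
    obtain ⟨h1, h2, h3⟩ := key fun f hf => h f (Or.inr hf)
    exact ⟨h1, h2, h3, fun w => (h _ (Or.inl ⟨w, rfl⟩)).2.2⟩
  · intro S d v hS hd hdS hv hvS h
    have hd' := hd.isProperSubharmonic hS hdS
    have hv' := hv.isProperSubharmonic hS hvS
    refine ⟨hd'.exists_isRieszMeasure, hv'.exists_isRieszMeasure, fun δ ω hδ hω => ?_⟩
    obtain ⟨hδc, hδ0⟩ := hδ.isCompactMeasure hS hdS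
    obtain ⟨hωc, hω0⟩ := hω.isCompactMeasure hS hvS
    exact ⟨⟨hδc, hδ0⟩, ⟨hωc, hω0⟩, isBalayage_mon hδ hω hδc hωc h,
      isBalayage_lnmon hδ hω hδc hωc h⟩
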